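/- Let $H>\tfrac12$, $\lambda>0$ and $d=\tfrac12-\tfrac{1-H}{2}$ (so $d>\tfrac14$), and let $W$ be a Gaussian white noise on $\mathbb{R}$, that is, an isonormal Gaussian process over $L^2(\mathbb{R})$. For $t\ge 0$ let $$h_t^\lambda(x_1,x_2)=\int_0^t \prod_{i=1}^{2} e^{-\lambda(s-x_i)}(s-x_i)^{d-1}\mathbf 1_{\{s>x_i\}}\,ds ,$$ and let $Z^\lambda(t)=I_2(h_t^\lambda)$ be its double Wiener–Itô integral with respect to $W$ (the tempered Rosenblatt process). Then $Z^\lambda(t)$ is well defined, in particular $h_t^\lambda\in L^2(\mathbb{R}^2)$; its moment generating function $\theta\mapsto E[e^{\theta Z^\lambda(t)}]$ is finite in a neighbourhood of $0$; and for every integer $m\ge 2$ the $m$-th cumulant $$C_m(Z^\lambda(t))=\frac{d^m}{d\theta^m}\log E\big[e^{\theta Z^\lambda(t)}\big]\Big|_{\theta=0}$$ is given by $$C_m(Z^\lambda(t)) = 2^{\,m-1+(\frac12-d)m}\,(m-1)!\,\lambda^{(\frac12-d)m}\left(\frac{\Gamma(d)}{\sqrt{\pi}}\right)^{m}\int_{[0,t]^m}\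 \prod_{j=1}^{m} K_{\frac12-d}\big(\lambda|s_j-s_{j+1}|\big)\,|s_j-s_{j+1}|^{d-\frac12}\;ds_1\cdots ds_m ,$$ where $s_{m+1}:=s_1$, the integral on the right converges absolutely, and $K_\nu$ is the modified Bessel function of the second kind, $K_\nu(x)=\int_0^\infty e^{-x\cosh u}\cosh(\nu u)\,du$ for $x>0$. -/

import Mathlib

open MeasureTheory ProbabilityTheory Filter Topology

/-- Modified Bessel function of the second kind `K_ν(x)`, for real order `ν` and `x > 0`,
given by `K_ν(x) = ∫_0^∞ exp(-x cosh u) cosh(ν u) du`. -/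
noncomputable def besselK (ν x : ℝ) : ℝ :=
  ∫ u in Set.Ioi (0 : ℝ), Real.exp (-x * Real.cosh u) * Real.cosh (ν * u)

/-- `W` is an isonormal Gaussian process (Gaussian white noise) over `L²(ℝ)` on the space
`(Ω, P)`: a centered Gaussian family with `E[W(φ) W(ψ)] = ⟨φ, ψ⟩`. -/
structure IsIsonormal {Ω : Type*} [MeasurableSpace Ω]
    (W : Lp ℝ 2 (volume : Measure ℝ) → Ω → ℝ) (P : Measure Ω) : Prop where
  gaussian : IsGaussianProcess W P
  centered : ∀ φ, ∫ ω, W φ ω ∂P = 0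
  covariance : ∀ φ ψ, ∫ ω, W φ ω * W ψ ω ∂P = inner ℝ φ ψ

/-- Data of an elementary function on `ℝ²` vanishing on the diagonal:
`(x, y) ↦ ∑ i j, c i j 1_{A i}(x) 1_{A j}(y)`, where the `A i` are pairwise disjoint measurable
sets of finite Lebesgue measure and `c i i = 0`. -/
structure OffDiagElementary where
  n : ℕ
  A : Fin n → Set ℝ
  measurableSet : ∀ i, MeasurableSet (A i)
  volume_ne_top : ∀ i, volume (A i) ≠ ⊤
  disjoint : Pairwise fun i j => Disjoint (A i) (A j)
  c : Fin n → Fin n → ℝ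
  c_diag : ∀ i, c i i = 0

namespace OffDiagElementary

/-- The elementary function itself. -/
noncomputable def toFun (S : OffDiagElementary) (x : ℝ × ℝ) : ℝ :=
  ∑ i, ∑ j, S.c i j * ((S.A i).indicator 1 x.1 * (S.A j).indicator 1 x.2)

/-- `W(A i)`, that is, `W` evaluated at the indicator function of `A i`. -/
noncomputable def noise (S : OffDiagElementary) {Ω : Type*}
    (W : Lp ℝ 2 (volume : Measure ℝ) → Ω → ℝ) (i : Fin S.n) : Ω → ℝ :=
  W (indicatorConstLp 2 (S.measurableSet i) (S.volume_ne_top i) (1 : ℝ))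

/-- The double Wiener-Itô integral `∑ i j, c i j W(A i) W(A j)` of the elementary function. -/
noncomputable def wienerIntegral (S : OffDiagElementary) {Ω : Type*}
    (W : Lp ℝ 2 (volume : Measure ℝ) → Ω → ℝ) (ω : Ω) : ℝ :=
  ∑ i, ∑ j, S.c i j * (S.noise W i ω * S.noise W j ω)

end OffDiagElementary

/-- `X` is (a version of) the double Wiener-Itô integral `I₂(f)` of `f ∈ L²(ℝ²)` with respect to
`W`: the limit in `L²(P)` of the integrals of elementary functions, vanishing on the diagonal,
that converge to `f` in `L²(ℝ²)`. -/
def IsDoubleWienerIntegral {Ω : Type*} [MeasurableSpace Ω]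
    (W : Lp ℝ 2 (volume : Measure ℝ) → Ω → ℝ) (P : Measure Ω)
    (f : ℝ × ℝ → ℝ) (X : Ω → ℝ) : Prop :=
  MemLp f 2 (volume : Measure (ℝ × ℝ)) ∧ MemLp X 2 P ∧
    ∃ S : ℕ → OffDiagElementary,
      Tendsto (fun n => eLpNorm (fun x => (S n).toFun x - f x) 2 (volume : Measure (ℝ × ℝ)))
        atTop (𝓝 0) ∧
      Tendsto (fun n => eLpNorm (fun ω => (S n).wienerIntegral W ω - X ω) 2 P) atTop (𝓝 0)

/-- The function `u ↦ e^{-λ u} u^{d-1} 1_{u > 0}`. -/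
noncomputable def temperedPower (d lam u : ℝ) : ℝ :=
  if 0 < u then Real.exp (-lam * u) * u ^ (d - 1) else 0

/-- The kernel `h_t^λ(x₁, x₂) = ∫_0^t ∏_{i = 1, 2} e^{-λ (s - x_i)_+} (s - x_i)_+^{d-1} ds`. -/
noncomputable def temperedKernel (d lam t : ℝ) (x : ℝ × ℝ) : ℝ :=
  ∫ s in (0 : ℝ)..t, temperedPower d lam (s - x.1) * temperedPower d lam (s - x.2)

/-- `Z` is the tempered Rosenblatt process `Z(t) = I₂(h_t^λ)`, `t ≥ 0`, driven by `W`. -/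
def IsTemperedRosenblatt {Ω : Type*} [MeasurableSpace Ω]
    (W : Lp ℝ 2 (volume : Measure ℝ) → Ω → ℝ) (P : Measure Ω)
    (d lam : ℝ) (Z : ℝ → Ω → ℝ) : Prop :=
  ∀ t, 0 ≤ t → IsDoubleWienerIntegral W P (temperedKernel d lam t) (Z t)

/-- The `m`-th cumulant of `X`: the `m`-th derivative at `0` of the cumulant generating function
`θ ↦ log E[exp(θ X)]`. -/
noncomputable def cumulant {Ω : Type*} [MeasurableSpace Ω]
    (m : ℕ) (X : Ω → ℝ) (P : Measure Ω) : ℝ :=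
  iteratedDeriv m (cgf X P) 0

/-- The cyclic product `∏_j K_{1/2-d}(λ |s_j - s_{j+1}|) |s_j - s_{j+1}|^{d-1/2}`, with
`s_{m+1} = s_1`. -/
noncomputable def cyclicBesselProduct (d lam : ℝ) (m : ℕ) (s : Fin m → ℝ) : ℝ :=
  ∏ j, besselK (1 / 2 - d) (lam * |s j - s (finRotate m j)|) *
    |s j - s (finRotate m j)| ^ (d - 1 / 2)

/-!
# Cumulants of the tempered Rosenblatt process

The argument has a probabilistic half, valid for every double Wiener-Itô integral `I₂(f)` of a
symmetric kernel `f ∈ L²(ℝ²)`, and an analytic half, which computes the traces that occur in it for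
the tempered kernel.

*Probabilistic half.* For an elementary kernel, `I₂` is a quadratic form with vanishing trace in
independent Gaussian variables. Diagonalizing its matrix `M` by an orthogonal transformation gives
`E[exp(θ I₂)] = ∏ k, (1 - 2 θ μ_k)^(-1/2) = exp(∑_{m ≥ 2} (2θ)^m / (2m) * tr(M^m))`
(`OffDiagElementary.exp_wienerIntegral`), and `tr(M^m)` is the trace of the `m`-th power of the
symmetrized step kernel (`OffDiagElementary.trace_symmMatrix_pow`). Elementary kernels are dense in
`L²(ℝ²)` and the elementary integral is bounded `L²(ℝ²) → L²(P)` (by Isserlis' formula for four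
Gaussian variables), so `I₂(f)` exists for every `f` (`exists_isDoubleWienerIntegral`). Traces of
powers are continuous in the `L²` norm, and near `0` the exponential moments are uniformly bounded
along an approximating sequence; the formula thus passes to the limit
(`integral_exp_doubleWienerIntegral`), and the cumulants are read off the power series
(`cumulant_doubleWienerIntegral`): the `m`-th one is `2^(m-1) (m-1)! tr(f^m)`.

*Analytic half.* With `g(u) = e^{-λu} u^{d-1} 1_{u > 0}`, the tempered kernel is
`h(x, y) = ∫_0^t g(s - x) g(s - y) ds`, so Tonelli's theorem turns `tr(h^m)` into the integral over
`[0, t]^m` of the cyclic product of `γ(s_j - s_{j+1})`, where `γ(r) = ∫ g(x) g(x + r) dx`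
(`lintegral_cyclic_temperedKernelE`). To identify `γ`, note that its two-sided Laplace transform is
`Γ(d)² (λ² - θ²)^(-d)`, which is also that of the mixture of the Gaussian densities of variance `2y`
with weight `Γ(d) y^{d-1} e^{-λ²y}`; hence the two agree almost everywhere
(`temperedCov_ae_eq_gaussianMixture`), and the substitution `y = |r| e^u / (2λ)` turns the mixture
into the integral representation of the Bessel function (`temperedCov_ae_eq_besselCov`). The mixture
also shows that `γ` is locally square integrable when `d > 1/4`
(`setLIntegral_temperedCov_sq_ne_top`), which is what places `h` in `L²(ℝ²)`.
-/

/-! ### Moments of jointly Gaussian variables -/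

lemma integral_pow_four_gaussianReal_one : ∫ x, x ^ 4 ∂(gaussianReal 0 1) = 3 := by
  rw [integral_gaussianReal_eq_integral_smul one_ne_zero]
  have h1 : ∀ x : ℝ, gaussianPDFReal 0 1 x • x ^ 4 =
      (√(2 * Real.pi))⁻¹ * (fun y : ℝ => y ^ 4 * Real.exp (-(1 / 2) * y ^ 2)) |x| := by
    intro x
    have h4 : |x| ^ 4 = x ^ 4 := by
      rw [show (4 : ℕ) = 2 * 2 from rfl, pow_mul, sq_abs, ← pow_mul]
    simp only [gaussianPDFReal, NNReal.coe_one, sub_zero, mul_one, sq_abs, h4, smul_eq_mul]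
    rw [show -x ^ 2 / 2 = -(1 / 2) * x ^ 2 by ring]
    ring
  simp_rw [h1]
  rw [integral_const_mul,
    integral_comp_abs (f := fun y : ℝ => y ^ 4 * Real.exp (-(1 / 2) * y ^ 2))]
  have h2 := integral_rpow_mul_exp_neg_mul_rpow (p := 2) (q := 4) (b := 1 / 2)
    (by norm_num) (by norm_num) (by norm_num)
  have h3 : ∫ x in Set.Ioi (0 : ℝ), x ^ 4 * Real.exp (-(1 / 2) * x ^ 2) =
      ∫ x in Set.Ioi (0 : ℝ), x ^ (4 : ℝ) * Real.exp (-(1 / 2) * x ^ (2 : ℝ)) := by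
    refine setIntegral_congr_fun measurableSet_Ioi fun x _ => ?_
    norm_cast
  rw [h3, h2]
  have hG : Real.Gamma ((4 + 1) / 2) = 3 / 4 * √Real.pi := by
    rw [show ((4 : ℝ) + 1) / 2 = (1 / 2 + 1) + 1 by norm_num, Real.Gamma_add_one (by norm_num),
      Real.Gamma_add_one (by norm_num), Real.Gamma_one_half_eq]
    ring
  have hb : (1 / 2 : ℝ) ^ (-(4 + 1) / 2 : ℝ) = 4 * √2 := by
    rw [one_div, Real.inv_rpow (by norm_num), ← Real.rpow_neg (by norm_num),
      show -(-(4 + 1) / 2 : ℝ) = 2 + 1 / 2 by norm_num, Real.rpow_add (by norm_num),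
      ← Real.sqrt_eq_rpow]
    norm_num
  rw [hG, hb, Real.sqrt_mul (by norm_num)]
  have : √2 ≠ 0 := by positivity
  have : √Real.pi ≠ 0 := by positivity
  field_simp

lemma integral_pow_four_gaussianReal (v : NNReal) :
    ∫ x, x ^ 4 ∂(gaussianReal 0 v) = 3 * (v : ℝ) ^ 2 := by
  have h := gaussianReal_map_const_mul (μ := 0) (v := 1) (NNReal.sqrt v : ℝ)
  have hv : NNReal.mk ((NNReal.sqrt v : ℝ) ^ 2) (sq_nonneg _) * 1 = v := by
    ext; simp
  rw [mul_zero, hv] at h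
  rw [← h, integral_map (by fun_prop) (by fun_prop)]
  simp_rw [mul_pow]
  rw [integral_const_mul, integral_pow_four_gaussianReal_one]
  have : ((NNReal.sqrt v : ℝ)) ^ 4 = (v : ℝ) ^ 2 := by
    rw [show (4 : ℕ) = 2 * 2 from rfl, pow_mul]
    simp
  rw [this]; ring

section Isonormal

variable {Ω : Type*} [MeasurableSpace Ω] {P : Measure Ω}
  {W : Lp ℝ 2 (volume : Measure ℝ) → Ω → ℝ}

namespace IsIsonormal

lemma memLp (hW : IsIsonormal W P) (φ : Lp ℝ 2 (volume : Measure ℝ)) {p : ENNReal} (hp : p ≠ ⊤) :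
    MemLp (W φ) p P := (hW.gaussian.hasGaussianLaw_eval φ).memLp hp

lemma hasGaussianLaw_pi (hW : IsIsonormal W P) {ι : Type*} [Fintype ι]
    (φ : ι → Lp ℝ 2 (volume : Measure ℝ)) :
    HasGaussianLaw (fun ω i => W (φ i) ω) P := by
  classical
  exact (hW.gaussian.hasGaussianLaw (Finset.univ.image φ)).map
    (ContinuousLinearMap.pi fun i => ContinuousLinearMap.proj
      (⟨φ i, Finset.mem_image_of_mem _ (Finset.mem_univ i)⟩ : Finset.univ.image φ))

lemma integrable_mul (hW : IsIsonormal W P) (φ ψ : Lp ℝ 2 (volume : Measure ℝ)) :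
    Integrable (fun ω => W φ ω * W ψ ω) P :=
  (hW.memLp φ (p := 2) ENNReal.ofNat_ne_top).integrable_mul
    (hW.memLp ψ (p := 2) ENNReal.ofNat_ne_top)

/-- A linear combination of the `W(φ i)` is a centered Gaussian variable, so its fourth moment is
three times the square of its second moment. -/
lemma integral_linComb_pow_four (hW : IsIsonormal W P) {ι : Type*} [Fintype ι]
    (φ : ι → Lp ℝ 2 (volume : Measure ℝ)) (c : ι → ℝ) :
    ∫ ω, (∑ i, c i * W (φ i) ω) ^ 4 ∂P =
      3 * (∑ i, ∑ j, c i * c j * inner ℝ (φ i) (φ j)) ^ 2 := by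
  have hP := hW.gaussian.isProbabilityMeasure
  have hX : HasGaussianLaw (fun ω => ∑ i, c i * W (φ i) ω) P := by
    have := (hW.hasGaussianLaw_pi φ).map
      (∑ i, c i • (ContinuousLinearMap.proj i : (ι → ℝ) →L[ℝ] ℝ))
    refine this.congr (Eventually.of_forall fun ω => ?_)
    simp
  have hmean : ∫ ω, (∑ i, c i * W (φ i) ω) ∂P = 0 := by
    rw [integral_finsetSum _ fun i _ =>
      ((hW.memLp (φ i) ENNReal.one_ne_top).integrable le_rfl).const_mul (c i)]
    simp [integral_const_mul, hW.centered]
  have hvar : Var[fun ω => ∑ i, c i * W (φ i) ω; P] =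
      ∑ i, ∑ j, c i * c j * inner ℝ (φ i) (φ j) := by
    rw [variance_of_integral_eq_zero hX.aemeasurable hmean]
    have : ∀ ω, (∑ i, c i * W (φ i) ω) ^ 2 =
        ∑ i, ∑ j, c i * c j * (W (φ i) ω * W (φ j) ω) := by
      intro ω
      rw [sq, Finset.sum_mul_sum]
      exact Finset.sum_congr rfl fun i _ => Finset.sum_congr rfl fun j _ => by ring
    simp_rw [this]
    rw [integral_finsetSum _ fun i _ => integrable_finsetSum _ fun j _ =>
      (hW.integrable_mul _ _).const_mul _]
    refine Finset.sum_congr rfl fun i _ => ?_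
    rw [integral_finsetSum _ fun j _ => (hW.integrable_mul _ _).const_mul _]
    refine Finset.sum_congr rfl fun j _ => ?_
    rw [integral_const_mul, hW.covariance]
  have hmap := hX.map_eq_gaussianReal
  rw [hmean] at hmap
  have h4 : ∫ ω, (∑ i, c i * W (φ i) ω) ^ 4 ∂P =
      ∫ x, x ^ 4 ∂(P.map (fun ω => ∑ i, c i * W (φ i) ω)) :=
    (integral_map (f := fun x => x ^ 4) hX.aemeasurable (by fun_prop)).symm
  rw [h4, hmap, integral_pow_four_gaussianReal, Real.coe_toNNReal _ (variance_nonneg _ _), hvar]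

/-- Isserlis' formula for four variables, from `integral_linComb_pow_four` by polarization. -/
lemma integral_mul_four (hW : IsIsonormal W P) (a b c d : Lp ℝ 2 (volume : Measure ℝ)) :
    ∫ ω, W a ω * W b ω * (W c ω * W d ω) ∂P =
      inner ℝ a b * inner ℝ c d + inner ℝ a c * inner ℝ b d + inner ℝ a d * inner ℝ b c := by
  have hP := hW.gaussian.isProbabilityMeasure
  have key : ∀ e₁ e₂ e₃ : ℝ,
      Integrable (fun ω => (W a ω + e₁ * W b ω + e₂ * W c ω + e₃ * W d ω) ^ 4) P ∧
      ∫ ω, (W a ω + e₁ * W b ω + e₂ * W c ω + e₃ * W d ω) ^ 4 ∂P =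
        3 * (inner ℝ a a + e₁ ^ 2 * inner ℝ b b + e₂ ^ 2 * inner ℝ c c + e₃ ^ 2 * inner ℝ d d
          + 2 * e₁ * inner ℝ a b + 2 * e₂ * inner ℝ a c + 2 * e₃ * inner ℝ a d
          + 2 * e₁ * e₂ * inner ℝ b c + 2 * e₁ * e₃ * inner ℝ b d
          + 2 * e₂ * e₃ * inner ℝ c d) ^ 2 := by
    intro e₁ e₂ e₃
    constructor
    · have h4 : MemLp (fun ω => W a ω + e₁ * W b ω + e₂ * W c ω + e₃ * W d ω) 4 P :=
        (((hW.memLp a ENNReal.ofNat_ne_top).add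
          ((hW.memLp b ENNReal.ofNat_ne_top).const_mul e₁)).add
          ((hW.memLp c ENNReal.ofNat_ne_top).const_mul e₂)).add
          ((hW.memLp d ENNReal.ofNat_ne_top).const_mul e₃)
      have := h4.integrable_norm_pow (p := 4) (by norm_num)
      refine this.congr (Eventually.of_forall fun ω => ?_)
      simp only [Real.norm_eq_abs]
      rw [show (4 : ℕ) = 2 * 2 from rfl, pow_mul, sq_abs, ← pow_mul]
    · have := hW.integral_linComb_pow_four ![a, b, c, d] ![1, e₁, e₂, e₃]
      simp only [Fin.sum_univ_four, Matrix.cons_val_zero, Matrix.cons_val_one, Matrix.cons_val,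
        one_mul] at this
      rw [this, real_inner_comm a b, real_inner_comm a c, real_inner_comm a d,
        real_inner_comm b c, real_inner_comm b d, real_inner_comm c d]
      ring
  -- `192 x y z w` is the signed sum of the eight fourth powers `(x ± y ± z ± w)⁴`.
  have hpol : ∀ ω, W a ω * W b ω * (W c ω * W d ω) = (1 / 192) * (
      ((W a ω + 1 * W b ω + 1 * W c ω + 1 * W d ω) ^ 4
      - (W a ω + 1 * W b ω + 1 * W c ω + (-1) * W d ω) ^ 4)
      - ((W a ω + 1 * W b ω + (-1) * W c ω + 1 * W d ω) ^ 4
      - (W a ω + 1 * W b ω + (-1) * W c ω + (-1) * W d ω) ^ 4)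
      - (((W a ω + (-1) * W b ω + 1 * W c ω + 1 * W d ω) ^ 4
      - (W a ω + (-1) * W b ω + 1 * W c ω + (-1) * W d ω) ^ 4)
      - ((W a ω + (-1) * W b ω + (-1) * W c ω + 1 * W d ω) ^ 4
      - (W a ω + (-1) * W b ω + (-1) * W c ω + (-1) * W d ω) ^ 4))) := by
    intro ω; ring
  simp_rw [hpol]
  rw [integral_const_mul, integral_sub, integral_sub, integral_sub, integral_sub, integral_sub,
    integral_sub, integral_sub, (key _ _ _).2, (key _ _ _).2, (key _ _ _).2, (key _ _ _).2,
    (key _ _ _).2, (key _ _ _).2, (key _ _ _).2, (key _ _ _).2]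
  · ring
  all_goals
    first
    | exact (key _ _ _).1
    | exact (key _ _ _).1.sub (key _ _ _).1
    | exact ((key _ _ _).1.sub (key _ _ _).1).sub ((key _ _ _).1.sub (key _ _ _).1)

lemma integrable_mul_four (hW : IsIsonormal W P) (a b c d : Lp ℝ 2 (volume : Measure ℝ)) :
    Integrable (fun ω => W a ω * W b ω * (W c ω * W d ω)) P := by
  have h : ∀ φ ψ, MemLp (fun ω => W φ ω * W ψ ω) 2 P := fun φ ψ => by
    have : ENNReal.HolderTriple 4 4 2 := ⟨by
      rw [← ENNReal.toReal_eq_toReal_iff' (by simp) (by simp),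
        ENNReal.toReal_add (by simp) (by simp)]
      simp; norm_num⟩
    exact (hW.memLp ψ (p := 4) ENNReal.ofNat_ne_top).mul (hW.memLp φ (p := 4) ENNReal.ofNat_ne_top)
  exact (h a b).integrable_mul (h c d)

lemma memLp_mul (hW : IsIsonormal W P) (a b : Lp ℝ 2 (volume : Measure ℝ)) :
    MemLp (fun ω => W a ω * W b ω) 2 P := by
  have hm : AEStronglyMeasurable (fun ω => W a ω * W b ω) P :=
    (hW.integrable_mul a b).aestronglyMeasurable
  rw [memLp_two_iff_integrable_sq hm]
  simpa only [sq] using hW.integrable_mul_four a b a b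

end IsIsonormal

end Isonormal

/-! ### The isometry for elementary integrals -/

namespace OffDiagElementary

/-- The class in `L²(ℝ)` of the indicator function of `A i`. -/
noncomputable def cell (S : OffDiagElementary) (i : Fin S.n) : Lp ℝ 2 (volume : Measure ℝ) :=
  indicatorConstLp 2 (S.measurableSet i) (S.volume_ne_top i) (1 : ℝ)

lemma indicator_mul_indicator_eq (S : OffDiagElementary) (i j : Fin S.n) :
    (fun x : ℝ × ℝ => (S.A i).indicator (1 : ℝ → ℝ) x.1 * (S.A j).indicator (1 : ℝ → ℝ) x.2) =
      (S.A i ×ˢ S.A j).indicator fun _ => (1 : ℝ) := by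
  ext x
  by_cases h1 : x.1 ∈ S.A i <;> by_cases h2 : x.2 ∈ S.A j <;> simp [h1, h2]

lemma measurable_toFun (S : OffDiagElementary) : Measurable S.toFun := by
  unfold toFun
  refine Finset.measurable_sum _ fun i _ => Finset.measurable_sum _ fun j _ => ?_
  exact measurable_const.mul
    (((measurable_one.indicator (S.measurableSet i)).comp measurable_fst).mul
    ((measurable_one.indicator (S.measurableSet j)).comp measurable_snd))

lemma memLp_toFun (S : OffDiagElementary) (p : ENNReal) :
    MemLp S.toFun p (volume : Measure (ℝ × ℝ)) := by
  unfold toFun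
  refine memLp_finsetSum _ fun i _ => memLp_finsetSum _ fun j _ => MemLp.const_mul ?_ _
  rw [indicator_mul_indicator_eq]
  refine memLp_indicator_const p ((S.measurableSet i).prod (S.measurableSet j)) _ (Or.inr ?_)
  rw [Measure.volume_eq_prod, Measure.prod_prod]
  exact ENNReal.mul_ne_top (S.volume_ne_top i) (S.volume_ne_top j)

lemma indicator_mul_indicator_eq_inter (S T : OffDiagElementary) (i : Fin S.n) (k : Fin T.n) :
    (fun x => (S.A i).indicator (1 : ℝ → ℝ) x * (T.A k).indicator (1 : ℝ → ℝ) x) =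
      (S.A i ∩ T.A k).indicator 1 := by
  rw [Set.inter_indicator_one]
  rfl

lemma integrable_indicator_mul (S T : OffDiagElementary) (i : Fin S.n) (k : Fin T.n) :
    Integrable fun x => (S.A i).indicator (1 : ℝ → ℝ) x * (T.A k).indicator (1 : ℝ → ℝ) x := by
  rw [indicator_mul_indicator_eq_inter]
  refine (integrable_indicator_iff ((S.measurableSet i).inter (T.measurableSet k))).2 ?_
  exact integrableOn_const
    (ne_top_of_le_ne_top (S.volume_ne_top i) (measure_mono Set.inter_subset_left))

lemma inner_cell_cell (S T : OffDiagElementary) (i : Fin S.n) (k : Fin T.n) :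
    inner ℝ (S.cell i) (T.cell k) =
      ∫ x, (S.A i).indicator (1 : ℝ → ℝ) x * (T.A k).indicator (1 : ℝ → ℝ) x := by
  rw [indicator_mul_indicator_eq_inter,
    integral_indicator_one ((S.measurableSet i).inter (T.measurableSet k)), cell, cell,
    L2.inner_indicatorConstLp_indicatorConstLp (𝕜 := ℝ) (S.measurableSet i) (T.measurableSet k)
      (S.volume_ne_top i) (T.volume_ne_top k)]
  simp

lemma inner_cell_of_ne (S : OffDiagElementary) {i j : Fin S.n} (h : i ≠ j) :
    inner ℝ (S.cell i) (S.cell j) = (0 : ℝ) := by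
  rw [inner_cell_cell, indicator_mul_indicator_eq_inter,
    Set.disjoint_iff_inter_eq_empty.1 (S.disjoint h)]
  simp

lemma inner_cell_self (S : OffDiagElementary) (i : Fin S.n) :
    inner ℝ (S.cell i) (S.cell i) = volume.real (S.A i) := by
  rw [inner_cell_cell, indicator_mul_indicator_eq_inter, Set.inter_self,
    integral_indicator_one (S.measurableSet i)]

lemma integral_sum_four {α : Type*} [MeasurableSpace α] {μ : Measure α} {m n : ℕ}
    {F : Fin m → Fin m → Fin n → Fin n → α → ℝ} (hF : ∀ i j k l, Integrable (F i j k l) μ) :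
    ∫ x, ∑ i, ∑ j, ∑ k, ∑ l, F i j k l x ∂μ = ∑ i, ∑ j, ∑ k, ∑ l, ∫ x, F i j k l x ∂μ := by
  rw [integral_finsetSum _ fun i _ => integrable_finsetSum _ fun j _ =>
    integrable_finsetSum _ fun k _ => integrable_finsetSum _ fun l _ => hF i j k l]
  refine Finset.sum_congr rfl fun i _ => ?_
  rw [integral_finsetSum _ fun j _ =>
    integrable_finsetSum _ fun k _ => integrable_finsetSum _ fun l _ => hF i j k l]
  refine Finset.sum_congr rfl fun j _ => ?_
  rw [integral_finsetSum _ fun k _ => integrable_finsetSum _ fun l _ => hF i j k l]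
  refine Finset.sum_congr rfl fun k _ => ?_
  rw [integral_finsetSum _ fun l _ => hF i j k l]

lemma sum_sum_mul_sum_sum {m n : ℕ} (f : Fin m → Fin m → ℝ) (g : Fin n → Fin n → ℝ) :
    (∑ i, ∑ j, f i j) * (∑ k, ∑ l, g k l) = ∑ i, ∑ j, ∑ k, ∑ l, f i j * g k l := by
  rw [Finset.sum_mul]
  refine Finset.sum_congr rfl fun i _ => ?_
  rw [Finset.sum_mul]
  refine Finset.sum_congr rfl fun j _ => ?_
  rw [Finset.mul_sum]
  exact Finset.sum_congr rfl fun k _ => Finset.mul_sum ..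

lemma integral_sub_sub_sub {α : Type*} [MeasurableSpace α] {μ : Measure α} {a b c d : α → ℝ}
    (ha : Integrable a μ) (hb : Integrable b μ) (hc : Integrable c μ) (hd : Integrable d μ) :
    ∫ x, a x - b x - (c x - d x) ∂μ =
      (∫ x, a x ∂μ) - (∫ x, b x ∂μ) - ((∫ x, c x ∂μ) - ∫ x, d x ∂μ) := by
  rw [integral_sub (f := fun x => a x - b x) (g := fun x => c x - d x) (ha.sub hb) (hc.sub hd),
    integral_sub ha hb, integral_sub hc hd]

lemma integral_toFun_mul_toFun (S T : OffDiagElementary) :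
    ∫ x, S.toFun x * T.toFun x = ∑ i, ∑ j, ∑ k, ∑ l, S.c i j * T.c k l *
      (inner ℝ (S.cell i) (T.cell k) * inner ℝ (S.cell j) (T.cell l)) := by
  have h : ∀ x, S.toFun x * T.toFun x = ∑ i, ∑ j, ∑ k, ∑ l, S.c i j * T.c k l *
      (((S.A i).indicator (1 : ℝ → ℝ) x.1 * (T.A k).indicator (1 : ℝ → ℝ) x.1) *
        ((S.A j).indicator (1 : ℝ → ℝ) x.2 * (T.A l).indicator (1 : ℝ → ℝ) x.2)) := by
    intro x
    simp only [toFun, sum_sum_mul_sum_sum]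
    exact Finset.sum_congr rfl fun i _ => Finset.sum_congr rfl fun j _ =>
      Finset.sum_congr rfl fun k _ => Finset.sum_congr rfl fun l _ => by ring
  simp_rw [h, Measure.volume_eq_prod]
  rw [integral_sum_four fun i j k l => ((integrable_indicator_mul S T i k).mul_prod
    (integrable_indicator_mul S T j l)).const_mul _]
  simp_rw [integral_const_mul, inner_cell_cell]
  exact Finset.sum_congr rfl fun i _ => Finset.sum_congr rfl fun j _ =>
    Finset.sum_congr rfl fun k _ => Finset.sum_congr rfl fun l _ => by
      rw [← integral_prod_mul]

/-- The function `x ↦ S x.swap`, as an elementary function. -/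
def swap (S : OffDiagElementary) : OffDiagElementary :=
  { S with
    c := fun i j => S.c j i
    c_diag := S.c_diag }

lemma toFun_swap (S : OffDiagElementary) (x : ℝ × ℝ) : S.swap.toFun x = S.toFun x.swap := by
  simp only [toFun, swap, Prod.fst_swap, Prod.snd_swap]
  rw [Finset.sum_comm]
  exact Finset.sum_congr rfl fun i _ => Finset.sum_congr rfl fun j _ => by ring

lemma integral_toFun_mul_toFun_swap (S T : OffDiagElementary) :
    ∫ x : ℝ × ℝ, S.toFun x * T.toFun x.swap = ∑ i, ∑ j, ∑ k, ∑ l, S.c i j * T.c k l *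
      (inner ℝ (S.cell i) (T.cell l) * inner ℝ (S.cell j) (T.cell k)) := by
  simp_rw [← toFun_swap, integral_toFun_mul_toFun]
  refine Finset.sum_congr rfl fun i _ => Finset.sum_congr rfl fun j _ => ?_
  rw [Finset.sum_comm]
  rfl

variable {Ω : Type*} [MeasurableSpace Ω] {P : Measure Ω}
  {W : Lp ℝ 2 (volume : Measure ℝ) → Ω → ℝ}

lemma memLp_wienerIntegral (hW : IsIsonormal W P) (S : OffDiagElementary) :
    MemLp (S.wienerIntegral W) 2 P := by
  unfold wienerIntegral
  exact memLp_finsetSum _ fun i _ => memLp_finsetSum _ fun j _ =>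
    (hW.memLp_mul (S.cell i) (S.cell j)).const_mul _

/-- Since an elementary function vanishes on the diagonal, the pairing of the two noises inside one
integral does not contribute to Isserlis' formula. -/
lemma integral_wienerIntegral_mul (hW : IsIsonormal W P) (S T : OffDiagElementary) :
    ∫ ω, S.wienerIntegral W ω * T.wienerIntegral W ω ∂P =
      (∫ x, S.toFun x * T.toFun x) + ∫ x : ℝ × ℝ, S.toFun x * T.toFun x.swap := by
  have h : ∀ ω, S.wienerIntegral W ω * T.wienerIntegral W ω =
      ∑ i, ∑ j, ∑ k, ∑ l, S.c i j * T.c k l *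
        (W (S.cell i) ω * W (S.cell j) ω * (W (T.cell k) ω * W (T.cell l) ω)) := by
    intro ω
    simp only [wienerIntegral, sum_sum_mul_sum_sum]
    exact Finset.sum_congr rfl fun i _ => Finset.sum_congr rfl fun j _ =>
      Finset.sum_congr rfl fun k _ => Finset.sum_congr rfl fun l _ => by
        simp only [noise, cell]
        ring
  simp_rw [h]
  rw [integral_sum_four fun i j k l => (hW.integrable_mul_four _ _ _ _).const_mul _,
    integral_toFun_mul_toFun, integral_toFun_mul_toFun_swap]
  simp_rw [← Finset.sum_add_distrib]
  refine Finset.sum_congr rfl fun i _ => Finset.sum_congr rfl fun j _ =>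
      Finset.sum_congr rfl fun k _ => Finset.sum_congr rfl fun l _ => ?_
  rw [integral_const_mul, hW.integral_mul_four]
  have h0 : S.c i j * inner ℝ (S.cell i) (S.cell j) = 0 := by
    rcases eq_or_ne i j with rfl | hij
    · rw [S.c_diag, zero_mul]
    · rw [S.inner_cell_of_ne hij, mul_zero]
  linear_combination (T.c k l * inner ℝ (T.cell k) (T.cell l)) * h0

/-- The double Wiener-Itô integral is bounded, by `√2`, on elementary functions in `L²`. -/
lemma integral_wienerIntegral_sub_sq_le (hW : IsIsonormal W P) (S T : OffDiagElementary) :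
    ∫ ω, (S.wienerIntegral W ω - T.wienerIntegral W ω) ^ 2 ∂P ≤
      2 * ∫ x, (S.toFun x - T.toFun x) ^ 2 := by
  have hI : ∀ U V : OffDiagElementary, Integrable (fun ω => U.wienerIntegral W ω *
      V.wienerIntegral W ω) P := fun U V =>
    (memLp_wienerIntegral hW U).integrable_mul (memLp_wienerIntegral hW V)
  have hF : ∀ U V : OffDiagElementary, Integrable fun x => U.toFun x * V.toFun x := fun U V =>
    (U.memLp_toFun 2).integrable_mul (V.memLp_toFun 2)
  have hF' : ∀ U V : OffDiagElementary, Integrable fun x : ℝ × ℝ => U.toFun x * V.toFun x.swap :=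
    fun U V => by simpa only [toFun_swap] using hF U V.swap
  have hfg : Integrable fun x => (S.toFun x - T.toFun x) ^ 2 :=
    ((S.memLp_toFun 2).sub (T.memLp_toFun 2)).integrable_sq
  have hfg' : Integrable fun x : ℝ × ℝ => (S.toFun x.swap - T.toFun x.swap) ^ 2 := by
    simpa only [toFun_swap, Pi.sub_apply] using
      ((S.swap.memLp_toFun 2).sub (T.swap.memLp_toFun 2)).integrable_sq
  have hcross : Integrable fun x : ℝ × ℝ =>
      (S.toFun x - T.toFun x) * (S.toFun x.swap - T.toFun x.swap) := by
    have := ((S.memLp_toFun 2).sub (T.memLp_toFun 2)).integrable_mul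
      ((S.swap.memLp_toFun 2).sub (T.swap.memLp_toFun 2))
    simp_rw [← toFun_swap]
    exact this
  have e1 : ∫ ω, (S.wienerIntegral W ω - T.wienerIntegral W ω) ^ 2 ∂P =
      ∫ x : ℝ × ℝ, (S.toFun x - T.toFun x) ^ 2 +
        (S.toFun x - T.toFun x) * (S.toFun x.swap - T.toFun x.swap) := by
    have h1 : ∀ ω, (S.wienerIntegral W ω - T.wienerIntegral W ω) ^ 2 =
        S.wienerIntegral W ω * S.wienerIntegral W ω - S.wienerIntegral W ω * T.wienerIntegral W ω
        - (T.wienerIntegral W ω * S.wienerIntegral W ω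
          - T.wienerIntegral W ω * T.wienerIntegral W ω) := fun ω => by ring
    have h2 : ∀ x : ℝ × ℝ, (S.toFun x - T.toFun x) ^ 2 +
        (S.toFun x - T.toFun x) * (S.toFun x.swap - T.toFun x.swap) =
        (S.toFun x * S.toFun x + S.toFun x * S.toFun x.swap)
        - (S.toFun x * T.toFun x + S.toFun x * T.toFun x.swap)
        - ((T.toFun x * S.toFun x + T.toFun x * S.toFun x.swap)
        - (T.toFun x * T.toFun x + T.toFun x * T.toFun x.swap)) := fun x => by ring
    have hFF : ∀ U V : OffDiagElementary, Integrable fun x : ℝ × ℝ =>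
      U.toFun x * V.toFun x + U.toFun x * V.toFun x.swap := fun U V => (hF U V).add (hF' U V)
    simp_rw [h1, h2]
    rw [integral_sub_sub_sub (hI _ _) (hI _ _) (hI _ _) (hI _ _),
      integral_sub_sub_sub (hFF _ _) (hFF _ _) (hFF _ _) (hFF _ _)]
    simp_rw [integral_wienerIntegral_mul hW]
    rw [integral_add (hF _ _) (hF' _ _), integral_add (hF _ _) (hF' _ _),
      integral_add (hF _ _) (hF' _ _), integral_add (hF _ _) (hF' _ _)]
  have e2 : ∫ x : ℝ × ℝ, (S.toFun x.swap - T.toFun x.swap) ^ 2 =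
      ∫ x, (S.toFun x - T.toFun x) ^ 2 := by
    rw [Measure.volume_eq_prod]
    exact integral_prod_swap (μ := (volume : Measure ℝ)) (ν := (volume : Measure ℝ))
      fun x => (S.toFun x - T.toFun x) ^ 2
  -- the integrand is at most `3/2 (S - T)² + 1/2 ((S - T) ∘ swap)²`
  calc _ = _ := e1
    _ ≤ ∫ x : ℝ × ℝ, 3 / 2 * (S.toFun x - T.toFun x) ^ 2 +
        1 / 2 * (S.toFun x.swap - T.toFun x.swap) ^ 2 := by
      refine integral_mono (hfg.add hcross)
        ((hfg.const_mul _).add (hfg'.const_mul _)) fun x => ?_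
      simp only
      nlinarith [sq_nonneg ((S.toFun x - T.toFun x) - (S.toFun x.swap - T.toFun x.swap))]
    _ = 2 * ∫ x, (S.toFun x - T.toFun x) ^ 2 := by
      rw [integral_add (hfg.const_mul _) (hfg'.const_mul _), integral_const_mul, integral_const_mul,
        e2]
      ring

end OffDiagElementary

/-! ### Density of elementary functions and existence of the double integral -/

lemma eLpNorm_two_sq {α : Type*} [MeasurableSpace α] {μ : Measure α} (f : α → ℝ) :
    eLpNorm f 2 μ ^ 2 = ∫⁻ x, ‖f x‖ₑ ^ 2 ∂μ := by
  have := eLpNorm_nnreal_pow_eq_lintegral (μ := μ) (f := f) (p := 2) two_ne_zero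
  simpa using this

lemma ofReal_integral_sq_eq_eLpNorm {α : Type*} [MeasurableSpace α] {μ : Measure α} {f : α → ℝ}
    (hf : MemLp f 2 μ) : ENNReal.ofReal (∫ x, f x ^ 2 ∂μ) = eLpNorm f 2 μ ^ 2 := by
  rw [eLpNorm_two_sq, ofReal_integral_eq_lintegral_ofReal hf.integrable_sq
    (Eventually.of_forall fun x => sq_nonneg _)]
  refine lintegral_congr fun x => ?_
  rw [← sq_abs, ENNReal.ofReal_pow (abs_nonneg _), Real.enorm_eq_ofReal_abs]

lemma tendsto_eLpNorm_two_of_sq {α ι : Type*} [MeasurableSpace α] {μ : Measure α} {l : Filter ι}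
    {f : ι → α → ℝ} (h : Tendsto (fun n => ∫⁻ x, ‖f n x‖ₑ ^ 2 ∂μ) l (𝓝 0)) :
    Tendsto (fun n => eLpNorm (f n) 2 μ) l (𝓝 0) := by
  have := ((ENNReal.continuous_rpow_const (y := 1 / 2)).tendsto 0).comp h
  rw [ENNReal.zero_rpow_of_pos (by norm_num)] at this
  refine this.congr fun n => ?_
  rw [Function.comp_apply, ← eLpNorm_two_sq, ← ENNReal.rpow_natCast, ← ENNReal.rpow_mul]
  norm_num

lemma ae_fst_ne_snd : ∀ᵐ x : ℝ × ℝ, x.1 ≠ x.2 := by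
  rw [ae_iff, Measure.volume_eq_prod]
  have : {x : ℝ × ℝ | ¬x.1 ≠ x.2} = Set.diagonal ℝ := by ext; simp
  rw [this, Measure.measure_prod_null measurableSet_diagonal]
  refine Eventually.of_forall fun x => ?_
  have : Prod.mk x ⁻¹' Set.diagonal ℝ = {x} := by ext; simp [eq_comm]
  simp [this]

lemma abs_floor_mul_div_sub_le {k : ℕ} (hk : 0 < k) (x : ℝ) :
    |(⌊k * x⌋ : ℝ) / k - x| ≤ 1 / k := by
  have hk' : (0 : ℝ) < k := by exact_mod_cast hk
  have h1 := Int.floor_le (k * x)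
  have h2 := Int.lt_floor_add_one (k * x)
  rw [abs_le]
  constructor
  · rw [neg_le_sub_iff_le_add, ← add_div, le_div_iff₀ hk']
    linarith
  · rw [sub_le_iff_le_add, div_le_iff₀ hk', add_mul, one_div_mul_cancel hk'.ne']
    linarith

namespace OffDiagElementary

lemma eLpNorm_wienerIntegral_sub_le {Ω : Type*} [MeasurableSpace Ω] {P : Measure Ω}
    {W : Lp ℝ 2 (volume : Measure ℝ) → Ω → ℝ} (hW : IsIsonormal W P) (S T : OffDiagElementary) :
    eLpNorm (fun ω => S.wienerIntegral W ω - T.wienerIntegral W ω) 2 P ≤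
      2 * eLpNorm (fun x => S.toFun x - T.toFun x) 2 volume := by
  have h1 := ofReal_integral_sq_eq_eLpNorm
    ((memLp_wienerIntegral hW S).sub (memLp_wienerIntegral hW T))
  have h2 := ofReal_integral_sq_eq_eLpNorm ((S.memLp_toFun 2).sub (T.memLp_toFun 2))
  have h3 := ENNReal.ofReal_le_ofReal (integral_wienerIntegral_sub_sq_le hW S T)
  rw [ENNReal.ofReal_mul (by norm_num)] at h3
  have h4 : eLpNorm (S.wienerIntegral W - T.wienerIntegral W) 2 P ^ 2 ≤
      (2 * eLpNorm (S.toFun - T.toFun) 2 volume) ^ 2 := by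
    rw [mul_pow, ← h1, ← h2]
    refine h3.trans (mul_le_mul_left ?_ _)
    norm_num
  exact (ENNReal.pow_le_pow_left_iff two_ne_zero).1 h4

/-- The grid approximation of `φ` with mesh `1 / k` on the square `[-k, k)²`: the value on a cell is
that of `φ` at its lower left corner, and zero on the diagonal cells. -/
noncomputable def grid (φ : ℝ × ℝ → ℝ) (k : ℕ) : OffDiagElementary where
  n := 2 * k ^ 2
  A i := {x | ⌊(k : ℝ) * x⌋ = (i : ℤ) - (k : ℤ) ^ 2}
  measurableSet i := by
    have : Measurable fun x : ℝ => ⌊(k : ℝ) * x⌋ := Int.measurable_floor.comp (by fun_prop)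
    exact this (measurableSet_singleton _)
  volume_ne_top i := by
    rcases Nat.eq_zero_or_pos k with rfl | hk
    · exact absurd i.2 (by simp)
    refine ne_top_of_le_ne_top (b := volume (Set.Icc (((i : ℤ) - (k : ℤ) ^ 2 : ℤ) / (k : ℝ))
      ((((i : ℤ) - (k : ℤ) ^ 2 : ℤ) + 1) / (k : ℝ)))) (by simp) (measure_mono fun x hx => ?_)
    have hk' : (0 : ℝ) < k := by exact_mod_cast hk
    have h := Int.floor_eq_iff.1 (Set.mem_ofPred_eq ▸ hx)
    exact ⟨by rw [div_le_iff₀ hk']; linarith [h.1], by rw [le_div_iff₀ hk']; linarith [h.2]⟩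
  disjoint i j hij := by
    refine Set.disjoint_left.2 fun x hx hx' => hij ?_
    simp only [Set.mem_ofPred_eq] at hx hx'
    ext
    omega
  c i j := if i = j then 0 else φ ((((i : ℤ) - (k : ℤ) ^ 2 : ℤ) : ℝ) / k,
    (((j : ℤ) - (k : ℤ) ^ 2 : ℤ) : ℝ) / k)
  c_diag i := by simp

lemma grid_toFun (φ : ℝ × ℝ → ℝ) (k : ℕ) (x : ℝ × ℝ) :
    (grid φ k).toFun x =
      if (-(k : ℤ) ^ 2 ≤ ⌊k * x.1⌋ ∧ ⌊k * x.1⌋ < (k : ℤ) ^ 2) ∧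
        (-(k : ℤ) ^ 2 ≤ ⌊k * x.2⌋ ∧ ⌊k * x.2⌋ < (k : ℤ) ^ 2) ∧ ⌊k * x.1⌋ ≠ ⌊k * x.2⌋ then
      φ ((⌊k * x.1⌋ : ℝ) / k, (⌊k * x.2⌋ : ℝ) / k) else 0 := by
  have hmem : ∀ (i : Fin (grid φ k).n) (y : ℝ),
      y ∈ (grid φ k).A i ↔ ⌊(k : ℝ) * y⌋ = (i : ℤ) - (k : ℤ) ^ 2 := fun i y => Iff.rfl
  have hn : (grid φ k).n = 2 * k ^ 2 := rfl
  have hout : ∀ (y : ℝ), ¬ (-(k : ℤ) ^ 2 ≤ ⌊k * y⌋ ∧ ⌊k * y⌋ < (k : ℤ) ^ 2) →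
      ∀ i, y ∉ (grid φ k).A i := by
    intro y hy i hi
    rw [hmem] at hi
    have : (i : ℕ) < 2 * k ^ 2 := i.2
    zify at this
    exact hy ⟨by omega, by omega⟩
  by_cases h1 : -(k : ℤ) ^ 2 ≤ ⌊k * x.1⌋ ∧ ⌊k * x.1⌋ < (k : ℤ) ^ 2
  swap
  · rw [if_neg fun h => h1 h.1]
    exact Finset.sum_eq_zero fun i _ => Finset.sum_eq_zero fun j _ => by simp [hout _ h1]
  by_cases h2 : -(k : ℤ) ^ 2 ≤ ⌊k * x.2⌋ ∧ ⌊k * x.2⌋ < (k : ℤ) ^ 2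
  swap
  · rw [if_neg fun h => h2 h.2.1]
    exact Finset.sum_eq_zero fun i _ => Finset.sum_eq_zero fun j _ => by simp [hout _ h2]
  have hex : ∀ z : ℤ, -(k : ℤ) ^ 2 ≤ z ∧ z < (k : ℤ) ^ 2 →
      ∃ i : Fin (grid φ k).n, z = (i : ℤ) - (k : ℤ) ^ 2 := by
    intro z hz
    refine ⟨⟨(z + (k : ℤ) ^ 2).toNat, ?_⟩, ?_⟩
    · rw [hn]; zify; rw [Int.toNat_of_nonneg (by omega)]; omega
    · simp only; rw [Int.toNat_of_nonneg (by omega)]; ring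
  obtain ⟨i, hi⟩ := hex _ h1
  obtain ⟨j, hj⟩ := hex _ h2
  have hi' : ∀ i', x.1 ∈ (grid φ k).A i' ↔ i' = i := by
    intro i'; rw [hmem, Fin.ext_iff]; omega
  have hj' : ∀ j', x.2 ∈ (grid φ k).A j' ↔ j' = j := by
    intro j'; rw [hmem, Fin.ext_iff]; omega
  have hsum : (grid φ k).toFun x = (grid φ k).c i j := by
    rw [toFun, Finset.sum_eq_single i, Finset.sum_eq_single j]
    · simp [(hi' i).2 rfl, (hj' j).2 rfl]
    · intro j' _ hne
      simp [mt (hj' j').1 hne]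
    · simp
    · intro i' _ hne
      exact Finset.sum_eq_zero fun j' _ => by simp [mt (hi' i').1 hne]
    · simp
  rw [hsum]
  have hij : ⌊k * x.1⌋ ≠ ⌊k * x.2⌋ ↔ i ≠ j := by rw [Ne, Ne, Fin.ext_iff]; omega
  by_cases hne : i = j
  · rw [if_neg fun h => hij.1 h.2.2 hne]
    exact if_pos hne
  · rw [if_pos ⟨h1, h2, hij.2 hne⟩, hi, hj]
    exact if_neg hne

lemma tendsto_grid {φ : ℝ × ℝ → ℝ} (hφ : Continuous φ) {x : ℝ × ℝ} (hx : x.1 ≠ x.2) :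
    Tendsto (fun k => (grid φ k).toFun x) atTop (𝓝 (φ x)) := by
  have hfl : ∀ y : ℝ, Tendsto (fun k : ℕ => (⌊k * y⌋ : ℝ) / k) atTop (𝓝 y) := by
    intro y
    rw [tendsto_iff_norm_sub_tendsto_zero]
    refine squeeze_zero' (Eventually.of_forall fun _ => norm_nonneg _) ?_
      tendsto_one_div_atTop_nhds_zero_nat
    filter_upwards [eventually_gt_atTop 0] with k hk
    exact abs_floor_mul_div_sub_le hk y
  have hlim : Tendsto (fun k : ℕ => φ ((⌊k * x.1⌋ : ℝ) / k, (⌊k * x.2⌋ : ℝ) / k)) atTop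
      (𝓝 (φ x)) := (hφ.tendsto x).comp ((hfl x.1).prodMk_nhds (hfl x.2))
  have hrange : ∀ y : ℝ, ∀ᶠ k : ℕ in atTop,
      -(k : ℤ) ^ 2 ≤ ⌊k * y⌋ ∧ ⌊k * y⌋ < (k : ℤ) ^ 2 := by
    intro y
    filter_upwards [eventually_gt_atTop 0,
      tendsto_natCast_atTop_atTop.eventually (eventually_gt_atTop |y|)] with k hk hy
    have hk' : (0 : ℝ) < k := by exact_mod_cast hk
    have := abs_lt.1 hy
    rw [Int.le_floor, Int.floor_lt]
    push_cast
    constructor <;> nlinarith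
  have hne : ∀ᶠ k : ℕ in atTop, ⌊k * x.1⌋ ≠ ⌊k * x.2⌋ := by
    have hpos : 0 < |x.1 - x.2| := abs_pos.2 (sub_ne_zero.2 hx)
    filter_upwards [tendsto_natCast_atTop_atTop.eventually
      (eventually_gt_atTop (1 / |x.1 - x.2|))] with k hk he
    have := Int.abs_sub_lt_one_of_floor_eq_floor he
    rw [← mul_sub, abs_mul, Nat.abs_cast] at this
    rw [div_lt_iff₀ hpos] at hk
    linarith
  refine hlim.congr' ?_
  filter_upwards [hrange x.1, hrange x.2, hne] with k h1 h2 h3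
  rw [grid_toFun, if_pos ⟨h1, h2, h3⟩]

lemma tendsto_eLpNorm_grid_sub {φ : ℝ × ℝ → ℝ} (hφ : Continuous φ) (hc : HasCompactSupport φ) :
    Tendsto (fun k => eLpNorm (fun x => (grid φ k).toFun x - φ x) 2 volume) atTop (𝓝 0) := by
  obtain ⟨M, hM⟩ := hφ.bounded_above_of_compact_support hc
  obtain ⟨R, hR⟩ := hc.isBounded.subset_closedBall (0 : ℝ × ℝ)
  have hM0 : 0 ≤ M := (norm_nonneg _).trans (hM 0)
  have hbound : ∀ (k : ℕ), 0 < k → ∀ x : ℝ × ℝ, ‖(grid φ k).toFun x - φ x‖ ≤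
      (Metric.closedBall (0 : ℝ × ℝ) (R + 1)).indicator (fun _ => 2 * M) x := by
    intro k hk x
    by_cases hx : x ∈ Metric.closedBall (0 : ℝ × ℝ) (R + 1)
    · rw [Set.indicator_of_mem hx]
      refine (norm_sub_le _ _).trans ?_
      have : ‖(grid φ k).toFun x‖ ≤ M := by
        rw [grid_toFun]; split_ifs
        · exact hM _
        · simpa using hM0
      linarith [hM x]
    · rw [Set.indicator_of_notMem hx]
      have hzero : ∀ y : ℝ × ℝ, ‖y - x‖ ≤ 1 → φ y = 0 := by
        intro y hy
        by_contra hne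
        have h1 := hR (subset_tsupport φ hne)
        rw [mem_closedBall_zero_iff] at h1 hx
        have := norm_sub_le y (y - x)
        rw [sub_sub_cancel] at this
        linarith
      have h1 : (grid φ k).toFun x = 0 := by
        rw [grid_toFun]; split_ifs
        · refine hzero _ ?_
          have h1k : (1 : ℝ) / k ≤ 1 := by
            rw [div_le_one (by exact_mod_cast hk)]; exact_mod_cast hk
          rw [Prod.norm_def, max_le_iff]
          exact ⟨(abs_floor_mul_div_sub_le hk _).trans h1k,
            (abs_floor_mul_div_sub_le hk _).trans h1k⟩
        · rfl
      rw [h1, hzero x (by simp)]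
      simp
  refine tendsto_eLpNorm_two_of_sq ?_
  have := tendsto_lintegral_filter_of_dominated_convergence (μ := (volume : Measure (ℝ × ℝ)))
    (l := atTop)
    (F := fun k x => ‖(grid φ k).toFun x - φ x‖ₑ ^ 2) (f := fun _ => 0)
    (fun x => (Metric.closedBall (0 : ℝ × ℝ) (R + 1)).indicator
      (fun _ => ENNReal.ofReal (2 * M) ^ 2) x)
    (Eventually.of_forall fun k =>
      (((grid φ k).measurable_toFun.sub hφ.measurable).enorm.pow_const 2))
    ?_ ?_ ?_
  · simpa using this
  · filter_upwards [eventually_gt_atTop 0] with k hk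
    refine Eventually.of_forall fun x => ?_
    have h1 := hbound k hk x
    by_cases hx : x ∈ Metric.closedBall (0 : ℝ × ℝ) (R + 1)
    · rw [Set.indicator_of_mem hx] at h1 ⊢
      rw [← ofReal_norm]
      gcongr
    · rw [Set.indicator_of_notMem hx] at h1 ⊢
      have h2 : (grid φ k).toFun x - φ x = 0 := norm_le_zero_iff.1 h1
      simp [h2]
  · rw [lintegral_indicator Metric.isClosed_closedBall.measurableSet, setLIntegral_const]
    exact ENNReal.mul_ne_top (ENNReal.pow_ne_top ENNReal.ofReal_ne_top)
      (isCompact_closedBall _ _).measure_lt_top.ne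
  · filter_upwards [ae_fst_ne_snd] with x hx
    have h1 := (tendsto_grid hφ hx).sub_const (φ x)
    rw [sub_self] at h1
    have h2 := (continuous_enorm.tendsto (0 : ℝ)).comp h1
    have h3 := ((ENNReal.continuous_pow 2).tendsto _).comp h2
    simpa [Function.comp_def] using h3

/-- Elementary functions vanishing on the diagonal are dense in `L²(ℝ²)`. -/
lemma exists_tendsto_toFun {f : ℝ × ℝ → ℝ} (hf : MemLp f 2 (volume : Measure (ℝ × ℝ))) :
    ∃ S : ℕ → OffDiagElementary,
      Tendsto (fun n => eLpNorm (fun x => (S n).toFun x - f x) 2 volume) atTop (𝓝 0) := by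
  have h : ∀ n : ℕ, ∃ S : OffDiagElementary,
      eLpNorm (fun x => S.toFun x - f x) 2 volume ≤ ((n : ENNReal) + 1)⁻¹ := by
    intro n
    set ε : ENNReal := ((n : ENNReal) + 1)⁻¹ / 2 with hε
    have hε0 : ε ≠ 0 := by simp [hε, ENNReal.div_eq_zero_iff]
    obtain ⟨φ, hc, hle, hcont, hm⟩ := hf.exists_hasCompactSupport_eLpNorm_sub_le
      (by norm_num) hε0
    have h1 := tendsto_eLpNorm_grid_sub hcont hc
    obtain ⟨k, hk⟩ := (h1.eventually (gt_mem_nhds (pos_iff_ne_zero.2 hε0))).exists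
    refine ⟨grid φ k, ?_⟩
    have : (fun x => (grid φ k).toFun x - f x) =
        ((grid φ k).toFun - φ) - (f - φ) := by ext; simp
    rw [this]
    refine (eLpNorm_sub_le (((grid φ k).memLp_toFun 2).sub hm).1 (hf.sub hm).1
      (by norm_num)).trans ?_
    calc _ ≤ ε + ε := add_le_add hk.le hle
      _ = _ := ENNReal.add_halves _
  choose S hS using h
  refine ⟨S, tendsto_of_tendsto_of_tendsto_of_le_of_le tendsto_const_nhds ?_
    (fun _ => zero_le) hS⟩
  have := ENNReal.tendsto_inv_nat_nhds_zero.comp (tendsto_add_atTop_nat 1)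
  refine this.congr fun n => ?_
  simp

end OffDiagElementary

/-- Every square integrable kernel has a double Wiener-Itô integral. -/
lemma exists_isDoubleWienerIntegral {Ω : Type*} [MeasurableSpace Ω] {P : Measure Ω}
    {W : Lp ℝ 2 (volume : Measure ℝ) → Ω → ℝ} (hW : IsIsonormal W P) {f : ℝ × ℝ → ℝ}
    (hf : MemLp f 2 (volume : Measure (ℝ × ℝ))) : ∃ X, IsDoubleWienerIntegral W P f X := by
  obtain ⟨S, hS⟩ := OffDiagElementary.exists_tendsto_toFun hf
  have hmem := fun n => OffDiagElementary.memLp_wienerIntegral hW (S n)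
  have hcau : CauchySeq fun n => (hmem n).toLp := by
    rw [EMetric.cauchySeq_iff]
    intro ε hε
    have hε' : 0 < ε / 4 := ENNReal.div_pos hε.ne' (by norm_num)
    obtain ⟨N, hN⟩ := eventually_atTop.1 (hS.eventually (gt_mem_nhds hε'))
    refine ⟨N, fun m hm n hn => ?_⟩
    rw [Lp.edist_toLp_toLp]
    refine (OffDiagElementary.eLpNorm_wienerIntegral_sub_le hW (S m) (S n)).trans_lt ?_
    have : (fun x => (S m).toFun x - (S n).toFun x) =
      (fun x => (S m).toFun x - f x) - (fun x => (S n).toFun x - f x) := by ext; simp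
    rw [this]
    calc _ ≤ 2 * (eLpNorm (fun x => (S m).toFun x - f x) 2 volume +
          eLpNorm (fun x => (S n).toFun x - f x) 2 volume) :=
          mul_le_mul_right (eLpNorm_sub_le (((S m).memLp_toFun 2).sub hf).1
            (((S n).memLp_toFun 2).sub hf).1 (by norm_num)) _
      _ < 2 * (ε / 4 + ε / 4) :=
        (ENNReal.mul_lt_mul_iff_right (by norm_num) (by norm_num)).2
          (ENNReal.add_lt_add (hN m hm) (hN n hn))
      _ = ε := by
        rw [← two_mul, ← mul_assoc]
        norm_num
        exact ENNReal.mul_div_cancel (by norm_num) (by norm_num)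
  obtain ⟨X, hX⟩ := cauchySeq_tendsto_of_complete hcau
  refine ⟨X, hf, Lp.memLp X, S, hS, ?_⟩
  exact (Lp.tendsto_Lp_iff_tendsto_eLpNorm'' _ hmem X (Lp.memLp X)).1
    (by simpa only [Lp.toLp_coeFn] using hX)

/-! ### Exponential moments of Gaussian quadratic forms -/

lemma exp_sq_gaussianReal {a : ℝ} (ha : 2 * a < 1) :
    Integrable (fun x => Real.exp (a * x ^ 2)) (gaussianReal 0 1) ∧
      ∫ x, Real.exp (a * x ^ 2) ∂(gaussianReal 0 1) = (√(1 - 2 * a))⁻¹ := by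
  have h1 : ∀ x : ℝ, gaussianPDFReal 0 1 x • Real.exp (a * x ^ 2) =
      (√(2 * Real.pi))⁻¹ * Real.exp (-(1 / 2 - a) * x ^ 2) := by
    intro x
    simp only [gaussianPDFReal, NNReal.coe_one, sub_zero, mul_one, smul_eq_mul]
    rw [mul_assoc, ← Real.exp_add]
    congr 2
    ring
  have hb : 0 < 1 / 2 - a := by linarith
  constructor
  · rw [gaussianReal_of_var_ne_zero 0 one_ne_zero, gaussianPDF_def,
      integrable_withDensity_iff_integrable_smul' (by fun_prop) (by simp)]
    have : ∀ x : ℝ, (ENNReal.ofReal (gaussianPDFReal 0 1 x)).toReal • Real.exp (a * x ^ 2) =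
        (√(2 * Real.pi))⁻¹ * Real.exp (-(1 / 2 - a) * x ^ 2) := by
      intro x
      rw [ENNReal.toReal_ofReal (gaussianPDFReal_nonneg _ _ _), h1]
    simp_rw [this]
    exact (integrable_exp_neg_mul_sq hb).const_mul _
  · rw [integral_gaussianReal_eq_integral_smul one_ne_zero]
    simp_rw [h1]
    rw [integral_const_mul, integral_gaussian, ← Real.sqrt_inv, ← Real.sqrt_inv, ← Real.sqrt_mul
      (by positivity)]
    congr 1
    field_simp

section QuadraticForm

variable {ι : Type*} [Fintype ι] [DecidableEq ι] {M : Matrix ι ι ℝ}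

lemma quadForm_eigenvectorBasis (hM : M.IsHermitian) (x : ι → ℝ) :
    ∑ i, ∑ j, M i j * ((∑ k, x k • hM.eigenvectorBasis k) i *
      (∑ k, x k • hM.eigenvectorBasis k) j) = ∑ k, hM.eigenvalues k * x k ^ 2 := by
  set v := ∑ k, x k • hM.eigenvectorBasis k with hv
  have h1 : Matrix.toEuclideanLin M v = ∑ k, (x k * hM.eigenvalues k) • hM.eigenvectorBasis k := by
    rw [hv, map_sum]
    refine Finset.sum_congr rfl fun k _ => ?_
    rw [map_smul, Matrix.toLpLin_apply, hM.mulVec_eigenvectorBasis, mul_smul]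
    rfl
  have h2 : inner ℝ v (Matrix.toEuclideanLin M v) = ∑ k, hM.eigenvalues k * x k ^ 2 := by
    rw [h1, hv, hM.eigenvectorBasis.orthonormal.inner_sum]
    refine Finset.sum_congr rfl fun k _ => ?_
    simp
    ring
  rw [← h2, PiLp.inner_apply]
  refine Finset.sum_congr rfl fun i _ => ?_
  simp only [Matrix.toLpLin_apply, Matrix.mulVec, dotProduct, RCLike.inner_apply, conj_trivial]
  rw [Finset.sum_mul]
  exact Finset.sum_congr rfl fun j _ => by ring

/-- By rotation invariance of the standard Gaussian measure, a quadratic form in independent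
standard Gaussian variables is distributed as `∑ k, μ k * ξ k ^ 2`, where the `μ k` are its
eigenvalues. -/
lemma exp_quadForm_gaussian (hM : M.IsHermitian) {θ : ℝ}
    (hθ : ∀ k, 2 * (θ * hM.eigenvalues k) < 1) :
    Integrable (fun x : ι → ℝ => Real.exp (θ * ∑ i, ∑ j, M i j * (x i * x j)))
        (Measure.pi fun _ => gaussianReal 0 1) ∧
      ∫ x : ι → ℝ, Real.exp (θ * ∑ i, ∑ j, M i j * (x i * x j))
        ∂(Measure.pi fun _ => gaussianReal 0 1) =
        ∏ k, (√(1 - 2 * (θ * hM.eigenvalues k)))⁻¹ := by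
  set F : EuclideanSpace ℝ ι → ℝ := fun v => Real.exp (θ * ∑ i, ∑ j, M i j * (v i * v j)) with hF
  have hFm : Continuous F := by rw [hF]; fun_prop
  have hmap := map_pi_eq_stdGaussian (ι := ι)
  rw [stdGaussian_eq_map_pi_orthonormalBasis hM.eigenvectorBasis] at hmap
  have hm1 : Measurable fun x : ι → ℝ => WithLp.toLp 2 x := by fun_prop
  have hm2 : Measurable fun x : ι → ℝ => ∑ k, x k • hM.eigenvectorBasis k := by fun_prop
  have hFx : ∀ x : ι → ℝ, F (∑ k, x k • hM.eigenvectorBasis k) =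
      ∏ k, Real.exp (θ * hM.eigenvalues k * x k ^ 2) := by
    intro x
    rw [hF]
    simp only
    rw [quadForm_eigenvectorBasis hM, Finset.mul_sum, Real.exp_sum]
    exact Finset.prod_congr rfl fun k _ => by ring_nf
  have hint : Integrable F
      (Measure.map (WithLp.toLp 2) (Measure.pi fun _ : ι => gaussianReal 0 1)) := by
    rw [hmap, integrable_map_measure hFm.aestronglyMeasurable hm2.aemeasurable]
    simp only [Function.comp_def, hFx]
    exact Integrable.fintype_prod fun k => (exp_sq_gaussianReal (hθ k)).1
  constructor
  · exact (integrable_map_measure hFm.aestronglyMeasurable hm1.aemeasurable).1 hint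
  · have h1 := integral_map (μ := Measure.pi fun _ : ι => gaussianReal 0 1)
      hm1.aemeasurable hFm.aestronglyMeasurable
    rw [hmap, integral_map hm2.aemeasurable hFm.aestronglyMeasurable] at h1
    simp_rw [hFx] at h1
    rw [integral_fintype_prod_eq_prod (fun k (y : ℝ) => Real.exp (θ * hM.eigenvalues k * y ^ 2))]
      at h1
    rw [← Finset.prod_congr rfl fun k _ => (exp_sq_gaussianReal (hθ k)).2]
    exact h1.symm

lemma trace_pow_eq_sum_eigenvalues (hM : M.IsHermitian) (m : ℕ) :
    (M ^ m).trace = ∑ k, hM.eigenvalues k ^ m := by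
  conv_lhs => rw [hM.spectral_theorem, ← map_pow, Unitary.conjStarAlgAut_apply,
    Matrix.trace_mul_cycle, Unitary.coe_star_mul_self, one_mul, Matrix.diagonal_pow,
    Matrix.trace_diagonal]
  simp

lemma abs_eigenvalue_le (hM : M.IsHermitian) {r : ℝ} (hr : 0 ≤ r) (h : (M ^ 2).trace ≤ r ^ 2)
    (k : ι) : |hM.eigenvalues k| ≤ r := by
  rw [trace_pow_eq_sum_eigenvalues hM] at h
  refine abs_le_of_sq_le_sq ?_ hr
  exact (Finset.single_le_sum (f := fun k => hM.eigenvalues k ^ 2)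
    (fun k _ => sq_nonneg _) (Finset.mem_univ k)).trans h

lemma prod_inv_sqrt_eq_exp {κ : Type*} [Fintype κ] {μ : κ → ℝ} {θ : ℝ}
    (h : ∀ k, |2 * (θ * μ k)| < 1)
    (h0 : ∑ k, μ k = 0) :
    ∏ k, (√(1 - 2 * (θ * μ k)))⁻¹ =
      Real.exp (∑' n : ℕ, (2 * θ) ^ (n + 2) / (2 * (n + 2)) * ∑ k, μ k ^ (n + 2)) := by
  have hs : ∀ k, HasSum (fun n : ℕ => (2 * (θ * μ k)) ^ (n + 2) / (2 * (n + 2)))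
      (Real.log (√(1 - 2 * (θ * μ k)))⁻¹ - θ * μ k) := by
    intro k
    have h1 := Real.hasSum_pow_div_log_of_abs_lt_one (h k)
    have h2 := ((hasSum_nat_add_iff' 1).2 h1).mul_left (1 / 2)
    have hpos : 0 < 1 - 2 * (θ * μ k) := by linarith [(abs_lt.1 (h k)).2]
    have e1 : Real.log (√(1 - 2 * (θ * μ k)))⁻¹ - θ * μ k = 1 / 2 * (-Real.log (1 - 2 * (θ * μ k)) -
        ∑ i ∈ Finset.range 1, (2 * (θ * μ k)) ^ (i + 1) / ((i : ℝ) + 1)) := by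
      rw [Real.log_inv, Real.log_sqrt hpos.le]
      simp
      ring
    rw [e1]
    refine h2.congr_fun fun n => ?_
    push_cast
    field_simp
    ring_nf
  have hsum := hasSum_sum (s := Finset.univ) fun k _ => hs k
  have e1 : ∀ n : ℕ, ∑ k, (2 * (θ * μ k)) ^ (n + 2) / (2 * ((n : ℝ) + 2)) =
      (2 * θ) ^ (n + 2) / (2 * (n + 2)) * ∑ k, μ k ^ (n + 2) := by
    intro n
    rw [Finset.mul_sum]
    exact Finset.sum_congr rfl fun k _ => by rw [← mul_assoc, mul_pow]; ring
  simp_rw [e1] at hsum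
  rw [hsum.tsum_eq, Finset.sum_sub_distrib, ← Finset.mul_sum, h0, mul_zero, sub_zero, Real.exp_sum]
  refine Finset.prod_congr rfl fun k _ => ?_
  have hpos : 0 < 1 - 2 * (θ * μ k) := by linarith [(abs_lt.1 (h k)).2]
  rw [Real.exp_log (by positivity)]

end QuadraticForm

namespace OffDiagElementary

variable (S : OffDiagElementary)

/-- The symmetrized coefficient matrix of `S` in the normalized basis `1_{A i} / √|A i|`. -/
noncomputable def symmMatrix : Matrix (Fin S.n) (Fin S.n) ℝ := fun i j =>
  √(volume.real (S.A i)) * ((S.c i j + S.c j i) / 2) * √(volume.real (S.A j))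

lemma symmMatrix_isHermitian : S.symmMatrix.IsHermitian := by
  ext i j
  simp only [Matrix.conjTranspose_apply, symmMatrix, star_trivial]
  ring

lemma trace_symmMatrix : S.symmMatrix.trace = 0 := by
  simp [Matrix.trace, symmMatrix, S.c_diag]

variable {Ω : Type*} [MeasurableSpace Ω] {P : Measure Ω}
  {W : Lp ℝ 2 (volume : Measure ℝ) → Ω → ℝ}

/-- The noises `W(A i)` of disjoint sets are independent. -/
lemma map_noise (hW : IsIsonormal W P) :
    P.map (fun ω i => S.noise W i ω) = (Measure.pi fun _ : Fin S.n => gaussianReal 0 1).map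
      (fun x i => √(volume.real (S.A i)) * x i) := by
  have hP := hW.gaussian.isProbabilityMeasure
  have hn : ∀ i, S.noise W i = W (S.cell i) := fun i => rfl
  have hG : HasGaussianLaw (fun ω i => S.noise W i ω) P := hW.hasGaussianLaw_pi S.cell
  have hind : iIndepFun (fun i => S.noise W i) P := by
    refine hG.iIndepFun_of_covariance_eq_zero fun i j hij => ?_
    rw [hn, hn, covariance_eq_sub (hW.memLp (S.cell i) (by simp)) (hW.memLp (S.cell j) (by simp))]
    rw [hW.centered, zero_mul, sub_zero]
    exact (hW.covariance (S.cell i) (S.cell j)).trans (S.inner_cell_of_ne hij)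
  have haem : ∀ i, AEMeasurable (S.noise W i) P := fun i => hW.gaussian.aemeasurable _
  rw [(iIndepFun_iff_map_fun_eq_pi_map haem).1 hind,
    Measure.pi_map_pi (fun i => by fun_prop)]
  congr 1
  ext1 i
  rw [hn, (hW.gaussian.hasGaussianLaw_eval (S.cell i)).map_eq_gaussianReal, hW.centered,
    gaussianReal_map_const_mul, mul_zero]
  congr 1
  ext
  have hv : Var[W (S.cell i); P] = volume.real (S.A i) := by
    rw [variance_of_integral_eq_zero (hW.gaussian.aemeasurable _) (hW.centered (S.cell i)),
      ← S.inner_cell_self i, ← hW.covariance]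
    exact integral_congr_ae (Eventually.of_forall fun ω => sq _)
  rw [hv, Real.coe_toNNReal _ measureReal_nonneg]
  simp [Real.sq_sqrt measureReal_nonneg]

/-- The moment generating function of an elementary double Wiener-Itô integral. -/
lemma exp_wienerIntegral (hW : IsIsonormal W P) {r θ : ℝ} (hr : 0 ≤ r)
    (hS : (S.symmMatrix ^ 2).trace ≤ r ^ 2) (hθ : 2 * |θ| * r < 1) :
    Integrable (fun ω => Real.exp (θ * S.wienerIntegral W ω)) P ∧
    ∫ ω, Real.exp (θ * S.wienerIntegral W ω) ∂P =
      Real.exp (∑' n : ℕ, (2 * θ) ^ (n + 2) / (2 * (n + 2)) * (S.symmMatrix ^ (n + 2)).trace) := by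
  set M := S.symmMatrix with hMdef
  have hM := S.symmMatrix_isHermitian
  have habs : ∀ k, |2 * (θ * hM.eigenvalues k)| < 1 := by
    intro k
    refine lt_of_le_of_lt ?_ hθ
    rw [abs_mul, abs_mul, abs_two, ← mul_assoc]
    exact mul_le_mul_of_nonneg_left (abs_eigenvalue_le hM hr hS k) (by positivity)
  have h0 : ∑ k, hM.eigenvalues k = 0 := by
    have := trace_pow_eq_sum_eigenvalues hM 1
    simp only [pow_one] at this
    rw [← this, trace_symmMatrix]
  obtain ⟨hi, he⟩ := exp_quadForm_gaussian hM fun k => (abs_lt.1 (habs k)).2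
  rw [prod_inv_sqrt_eq_exp habs h0] at he
  simp_rw [← trace_pow_eq_sum_eigenvalues hM] at he
  have hG : AEMeasurable (fun ω i => S.noise W i ω) P :=
    (hW.hasGaussianLaw_pi S.cell).aemeasurable
  set F : (Fin S.n → ℝ) → ℝ := fun y => Real.exp (θ * ∑ i, ∑ j, S.c i j * (y i * y j)) with hF
  have hFm : Continuous F := by rw [hF]; fun_prop
  have hscale : Measurable fun (x : Fin S.n → ℝ) i => √(volume.real (S.A i)) * x i := by fun_prop
  have hFx : ∀ x : Fin S.n → ℝ, F (fun i => √(volume.real (S.A i)) * x i) =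
      Real.exp (θ * ∑ i, ∑ j, M i j * (x i * x j)) := by
    intro x
    rw [hF]
    simp only
    congr 2
    have e1 : ∑ i, ∑ j, M i j * (x i * x j) =
        ∑ i, ∑ j, (1 / 2 * (S.c i j * (√(volume.real (S.A i)) * x i *
          (√(volume.real (S.A j)) * x j))) + 1 / 2 * (S.c j i * (√(volume.real (S.A j)) * x j *
          (√(volume.real (S.A i)) * x i)))) := by
      refine Finset.sum_congr rfl fun i _ => Finset.sum_congr rfl fun j _ => ?_
      rw [hMdef, symmMatrix]
      ring
    rw [e1]
    simp_rw [Finset.sum_add_distrib, ← Finset.mul_sum]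
    rw [Finset.sum_comm (f := fun i j => S.c j i * (√(volume.real (S.A j)) * x j *
          (√(volume.real (S.A i)) * x i)))]
    ring
  have hFI : Integrable F (P.map fun ω i => S.noise W i ω) := by
    rw [S.map_noise hW, integrable_map_measure hFm.aestronglyMeasurable hscale.aemeasurable]
    simpa only [Function.comp_def, hFx] using hi
  constructor
  · exact (integrable_map_measure hFm.aestronglyMeasurable hG).1 hFI
  · have h1 := integral_map hG hFm.aestronglyMeasurable
    rw [S.map_noise hW, integral_map hscale.aemeasurable hFm.aestronglyMeasurable] at h1
    simp_rw [hFx] at h1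
    rw [← he, h1]
    rfl

end OffDiagElementary

/-! ### Square integrable kernels: composition and traces of powers -/

lemma ENNReal_sq_lintegral_mul_le {α : Type*} [MeasurableSpace α] {μ : Measure α}
    {f g : α → ENNReal} (hf : AEMeasurable f μ) (hg : AEMeasurable g μ) :
    (∫⁻ x, f x * g x ∂μ) ^ 2 ≤ (∫⁻ x, f x ^ 2 ∂μ) * ∫⁻ x, g x ^ 2 ∂μ := by
  have h := ENNReal.lintegral_mul_le_Lp_mul_Lq μ Real.HolderConjugate.two_two hf hg
  have h2 := pow_le_pow_left₀ zero_le h 2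
  simp only [Pi.mul_apply] at h2
  refine h2.trans_eq ?_
  rw [mul_pow, ← ENNReal.rpow_natCast, ← ENNReal.rpow_natCast, ← ENNReal.rpow_mul,
    ← ENNReal.rpow_mul]
  norm_num

/-- The composition `(x, z) ↦ ∫ F(x, y) G(y, z) dy` of two kernels on `ℝ`. -/
noncomputable def kernelComp (F G : ℝ × ℝ → ℝ) (p : ℝ × ℝ) : ℝ :=
  ∫ y, F (p.1, y) * G (y, p.2)

/-- The `(n + 1)`-st power of a kernel with respect to composition. -/
noncomputable def kernelPow (F : ℝ × ℝ → ℝ) : ℕ → ℝ × ℝ → ℝ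
  | 0 => F
  | n + 1 => kernelComp F (kernelPow F n)

/-- The trace of the composition of two square integrable kernels. -/
noncomputable def kernelTrace (F G : ℝ × ℝ → ℝ) : ℝ := ∫ x : ℝ × ℝ, F x * G x.swap

section KernelPow

variable {F G F' G' : ℝ × ℝ → ℝ}

lemma MeasureTheory.StronglyMeasurable.kernelComp (hF : StronglyMeasurable F)
    (hG : StronglyMeasurable G) : StronglyMeasurable (_root_.kernelComp F G) := by
  have h : StronglyMeasurable fun q : (ℝ × ℝ) × ℝ => F (q.1.1, q.2) * G (q.2, q.1.2) :=
    (hF.comp_measurable (by fun_prop)).mul (hG.comp_measurable (by fun_prop))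
  exact h.integral_prod_right

lemma MeasureTheory.StronglyMeasurable.kernelPow (hF : StronglyMeasurable F) (n : ℕ) :
    StronglyMeasurable (_root_.kernelPow F n) := by
  induction n with
  | zero => exact hF
  | succ n ih => exact hF.kernelComp ih

lemma lintegral_sq_kernelComp_le (hF : StronglyMeasurable F) (hG : StronglyMeasurable G) :
    ∫⁻ p : ℝ × ℝ, (∫⁻ y, ‖F (p.1, y)‖ₑ * ‖G (y, p.2)‖ₑ) ^ 2 ≤
      eLpNorm F 2 volume ^ 2 * eLpNorm G 2 volume ^ 2 := by
  have hF' : Measurable fun x => ‖F x‖ₑ := hF.measurable.enorm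
  have hG' : Measurable fun x => ‖G x‖ₑ := hG.measurable.enorm
  calc _ ≤ ∫⁻ p : ℝ × ℝ, (∫⁻ y, ‖F (p.1, y)‖ₑ ^ 2) * ∫⁻ y, ‖G (y, p.2)‖ₑ ^ 2 :=
        lintegral_mono fun p => ENNReal_sq_lintegral_mul_le
          (hF'.comp (by fun_prop)).aemeasurable (hG'.comp (by fun_prop)).aemeasurable
    _ = (∫⁻ x, ∫⁻ y, ‖F (x, y)‖ₑ ^ 2) * ∫⁻ z, ∫⁻ y, ‖G (y, z)‖ₑ ^ 2 := by
      rw [Measure.volume_eq_prod, lintegral_prod_mul (f := fun x => ∫⁻ y, ‖F (x, y)‖ₑ ^ 2)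
        (g := fun z => ∫⁻ y, ‖G (y, z)‖ₑ ^ 2)]
      · exact (Measurable.lintegral_prod_right' (f := fun x => ‖F x‖ₑ ^ 2)
          (hF'.pow_const 2)).aemeasurable
      · exact (Measurable.lintegral_prod_left' (f := fun x => ‖G x‖ₑ ^ 2)
          (hG'.pow_const 2)).aemeasurable
    _ = _ := by
      rw [eLpNorm_two_sq, eLpNorm_two_sq, Measure.volume_eq_prod,
        lintegral_prod _ (hF'.pow_const 2).aemeasurable,
        lintegral_prod_symm _ (hG'.pow_const 2).aemeasurable]

lemma eLpNorm_kernelComp_le (hF : StronglyMeasurable F) (hG : StronglyMeasurable G) :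
    eLpNorm (kernelComp F G) 2 volume ≤ eLpNorm F 2 volume * eLpNorm G 2 volume := by
  refine (ENNReal.pow_le_pow_left_iff two_ne_zero).1 ?_
  rw [mul_pow, eLpNorm_two_sq]
  refine (lintegral_mono fun p => ?_).trans (lintegral_sq_kernelComp_le hF hG)
  refine pow_le_pow_left₀ zero_le ?_ 2
  refine (enorm_integral_le_lintegral_enorm _).trans_eq ?_
  simp_rw [enorm_mul]

lemma MeasureTheory.MemLp.kernelComp (hF : StronglyMeasurable F) (hG : StronglyMeasurable G)
    (hF2 : MemLp F 2 volume) (hG2 : MemLp G 2 volume) : MemLp (_root_.kernelComp F G) 2 volume :=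
  ⟨(hF.kernelComp hG).aestronglyMeasurable,
    (eLpNorm_kernelComp_le hF hG).trans_lt (ENNReal.mul_lt_top hF2.2 hG2.2)⟩

lemma ae_integrable_kernelComp (hF : StronglyMeasurable F) (hG : StronglyMeasurable G)
    (hF2 : MemLp F 2 volume) (hG2 : MemLp G 2 volume) :
    ∀ᵐ p : ℝ × ℝ, Integrable fun y => F (p.1, y) * G (y, p.2) := by
  have hF' : Measurable fun x => ‖F x‖ₑ := hF.measurable.enorm
  have hG' : Measurable fun x => ‖G x‖ₑ := hG.measurable.enorm
  have hm : Measurable fun p : ℝ × ℝ => ∫⁻ y, ‖F (p.1, y)‖ₑ * ‖G (y, p.2)‖ₑ :=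
    Measurable.lintegral_prod_right' (f := fun q : (ℝ × ℝ) × ℝ =>
      ‖F (q.1.1, q.2)‖ₑ * ‖G (q.2, q.1.2)‖ₑ)
      ((hF'.comp (by fun_prop)).mul (hG'.comp (by fun_prop)))
  have hfin := ae_lt_top (hm.pow_const 2) ((lintegral_sq_kernelComp_le hF hG).trans_lt
    (ENNReal.mul_lt_top (ENNReal.pow_lt_top hF2.2) (ENNReal.pow_lt_top hG2.2))).ne
  filter_upwards [hfin] with p hp
  refine ⟨((hF.comp_measurable (by fun_prop)).mul
    (hG.comp_measurable (by fun_prop))).aestronglyMeasurable, ?_⟩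
  rw [hasFiniteIntegral_iff_enorm]
  simp_rw [enorm_mul]
  by_contra h
  rw [not_lt, top_le_iff] at h
  rw [h] at hp
  simp at hp

lemma MeasureTheory.MemLp.kernelPow (hF : StronglyMeasurable F) (hF2 : MemLp F 2 volume) (n : ℕ) :
    MemLp (_root_.kernelPow F n) 2 volume := by
  induction n with
  | zero => exact hF2
  | succ n ih => exact MemLp.kernelComp hF (hF.kernelPow n) hF2 ih

lemma eLpNorm_kernelPow_le (hF : StronglyMeasurable F) (n : ℕ) :
    eLpNorm (kernelPow F n) 2 volume ≤ eLpNorm F 2 volume ^ (n + 1) := by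
  induction n with
  | zero => simp [_root_.kernelPow]
  | succ n ih =>
    rw [pow_succ' _ (n + 1)]
    exact (eLpNorm_kernelComp_le hF (hF.kernelPow n)).trans (mul_le_mul_right ih _)

lemma kernelComp_sub_ae (hF : StronglyMeasurable F) (hG : StronglyMeasurable G)
    (hF' : StronglyMeasurable F') (hG' : StronglyMeasurable G')
    (hF2 : MemLp F 2 volume) (hG2 : MemLp G 2 volume)
    (hF2' : MemLp F' 2 volume) (hG2' : MemLp G' 2 volume) :
    (kernelComp F G - kernelComp F' G' : ℝ × ℝ → ℝ) =ᵐ[volume]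
      kernelComp (F - F') G + kernelComp F' (G - G') := by
  filter_upwards [ae_integrable_kernelComp hF hG hF2 hG2,
    ae_integrable_kernelComp hF' hG hF2' hG2,
    ae_integrable_kernelComp hF' hG' hF2' hG2'] with p h1 h2 h3
  simp only [Pi.sub_apply, Pi.add_apply, kernelComp, sub_mul, mul_sub]
  rw [integral_sub h1 h2, integral_sub h2 h3]
  ring

section Limits

variable {f : ℕ → ℝ × ℝ → ℝ} {g : ℝ × ℝ → ℝ}

lemma tendsto_eLpNorm_of_sub (hf2 : ∀ n, MemLp (f n) 2 volume) (hg2 : MemLp g 2 volume)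
    (h : Tendsto (fun n => eLpNorm (f n - g) 2 volume) atTop (𝓝 0)) :
    ∀ᶠ n in atTop, eLpNorm (f n) 2 volume ≤ 1 + eLpNorm g 2 volume := by
  filter_upwards [h.eventually (gt_mem_nhds one_pos)] with n hn
  have : f n = (f n - g) + g := by simp
  rw [this]
  exact (eLpNorm_add_le ((hf2 n).sub hg2).1 hg2.1 (by norm_num)).trans
    (add_le_add hn.le le_rfl)

lemma tendsto_kernelPow (hf : ∀ n, StronglyMeasurable (f n)) (hg : StronglyMeasurable g)
    (hf2 : ∀ n, MemLp (f n) 2 volume) (hg2 : MemLp g 2 volume)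
    (h : Tendsto (fun n => eLpNorm (f n - g) 2 volume) atTop (𝓝 0)) (m : ℕ) :
    Tendsto (fun n => eLpNorm (kernelPow (f n) m - kernelPow g m) 2 volume) atTop (𝓝 0) := by
  induction m with
  | zero => exact h
  | succ m ih =>
    set C : ENNReal := (1 + eLpNorm g 2 volume) ^ (m + 1) with hC
    have hCtop : C ≠ ⊤ := ENNReal.pow_ne_top (by finiteness [hg2.2.ne])
    have hlim : Tendsto (fun n => eLpNorm (f n - g) 2 volume * C + eLpNorm g 2 volume *
        eLpNorm (kernelPow (f n) m - kernelPow g m) 2 volume) atTop (𝓝 0) := by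
      have h1 := ENNReal.Tendsto.mul_const (b := C) h (Or.inr hCtop)
      have h2 := ENNReal.Tendsto.const_mul (a := eLpNorm g 2 volume) ih (Or.inr hg2.2.ne)
      simpa using h1.add h2
    refine tendsto_of_tendsto_of_tendsto_of_le_of_le' tendsto_const_nhds hlim
      (Eventually.of_forall fun _ => zero_le) ?_
    filter_upwards [tendsto_eLpNorm_of_sub hf2 hg2 h] with n hn
    have hp := fun n => (hf n).kernelPow m
    have hp2 := fun n => MemLp.kernelPow (hf n) (hf2 n) m
    have hq := hg.kernelPow m
    have hq2 := MemLp.kernelPow hg hg2 m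
    have e1 := eLpNorm_congr_ae (p := 2) (kernelComp_sub_ae (hf n) (hp n) hg hq (hf2 n) (hp2 n)
      hg2 hq2)
    refine e1.trans_le ((eLpNorm_add_le (((hf n).sub hg).kernelComp (hp n)).aestronglyMeasurable
      (hg.kernelComp ((hp n).sub hq)).aestronglyMeasurable (by norm_num)).trans ?_)
    refine add_le_add ((eLpNorm_kernelComp_le ((hf n).sub hg) (hp n)).trans ?_)
      (eLpNorm_kernelComp_le hg ((hp n).sub hq))
    refine mul_le_mul_right ((eLpNorm_kernelPow_le (hf n) m).trans ?_) _
    exact pow_le_pow_left₀ zero_le hn _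

end Limits

lemma eLpNorm_comp_swap (hG : StronglyMeasurable G) :
    eLpNorm (fun x : ℝ × ℝ => G x.swap) 2 volume = eLpNorm G 2 volume := by
  rw [Measure.volume_eq_prod]
  exact eLpNorm_comp_measurePreserving hG.aestronglyMeasurable
    (Measure.measurePreserving_swap (μ := (volume : Measure ℝ)) (ν := (volume : Measure ℝ)))

lemma MeasureTheory.MemLp.comp_swap (hG : StronglyMeasurable G) (hG2 : MemLp G 2 volume) :
    MemLp (fun x : ℝ × ℝ => G x.swap) 2 volume :=
  ⟨(hG.comp_measurable measurable_swap).aestronglyMeasurable, by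
    rw [eLpNorm_comp_swap hG]; exact hG2.2⟩

lemma integrable_mul_comp_swap (hG : StronglyMeasurable G)
    (hF2 : MemLp F 2 volume) (hG2 : MemLp G 2 volume) :
    Integrable fun x : ℝ × ℝ => F x * G x.swap :=
  hF2.integrable_mul (MemLp.comp_swap hG hG2)

lemma abs_kernelTrace_le (hF : StronglyMeasurable F) (hG : StronglyMeasurable G)
    (hF2 : MemLp F 2 volume) (hG2 : MemLp G 2 volume) :
    |kernelTrace F G| ≤ (eLpNorm F 2 volume).toReal * (eLpNorm G 2 volume).toReal := by
  rw [← ENNReal.toReal_mul]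
  have h : ENNReal.ofReal |kernelTrace F G| ≤ eLpNorm F 2 volume * eLpNorm G 2 volume := by
    rw [← Real.enorm_eq_ofReal_abs]
    refine (enorm_integral_le_lintegral_enorm _).trans ?_
    refine (ENNReal.pow_le_pow_left_iff two_ne_zero).1 ?_
    rw [mul_pow, ← eLpNorm_comp_swap hG, eLpNorm_two_sq, eLpNorm_two_sq]
    simp_rw [enorm_mul]
    exact ENNReal_sq_lintegral_mul_le hF.measurable.enorm.aemeasurable
      (hG.comp_measurable measurable_swap).measurable.enorm.aemeasurable
  rw [← ENNReal.toReal_ofReal (abs_nonneg (kernelTrace F G))]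
  exact ENNReal.toReal_mono (ENNReal.mul_lt_top hF2.2 hG2.2).ne h

lemma abs_kernelTrace_kernelPow_le (hF : StronglyMeasurable F) (hF2 : MemLp F 2 volume) (n : ℕ) :
    |kernelTrace F (kernelPow F n)| ≤ (eLpNorm F 2 volume).toReal ^ (n + 2) := by
  refine (abs_kernelTrace_le hF (hF.kernelPow n) hF2 (MemLp.kernelPow hF hF2 n)).trans ?_
  rw [pow_succ' _ (n + 1), ← ENNReal.toReal_pow _ (n + 1)]
  exact mul_le_mul_of_nonneg_left (ENNReal.toReal_mono (ENNReal.pow_ne_top hF2.2.ne)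
    (eLpNorm_kernelPow_le hF n)) ENNReal.toReal_nonneg

lemma kernelTrace_sub (hG : StronglyMeasurable G) (hG' : StronglyMeasurable G')
    (hF2 : MemLp F 2 volume) (hG2 : MemLp G 2 volume)
    (hF2' : MemLp F' 2 volume) (hG2' : MemLp G' 2 volume) :
    kernelTrace F G - kernelTrace F' G' = kernelTrace (F - F') G + kernelTrace F' (G - G') := by
  simp only [kernelTrace, Pi.sub_apply, sub_mul, mul_sub]
  rw [integral_sub (integrable_mul_comp_swap hG hF2 hG2) (integrable_mul_comp_swap hG hF2' hG2),
    integral_sub (integrable_mul_comp_swap hG hF2' hG2) (integrable_mul_comp_swap hG' hF2' hG2')]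
  ring

lemma tendsto_kernelTrace_kernelPow {f : ℕ → ℝ × ℝ → ℝ} {g : ℝ × ℝ → ℝ}
    (hf : ∀ n, StronglyMeasurable (f n)) (hg : StronglyMeasurable g)
    (hf2 : ∀ n, MemLp (f n) 2 volume) (hg2 : MemLp g 2 volume)
    (h : Tendsto (fun n => eLpNorm (f n - g) 2 volume) atTop (𝓝 0)) (m : ℕ) :
    Tendsto (fun n => kernelTrace (f n) (kernelPow (f n) m)) atTop
      (𝓝 (kernelTrace g (kernelPow g m))) := by
  rw [tendsto_iff_norm_sub_tendsto_zero]
  have h0 : ∀ {u : ℕ → ENNReal}, Tendsto u atTop (𝓝 0) →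
      Tendsto (fun n => (u n).toReal) atTop (𝓝 0) := fun hu =>
    (ENNReal.tendsto_toReal ENNReal.zero_ne_top).comp hu
  have h1 := h0 h
  have h2 := h0 (tendsto_kernelPow hf hg hf2 hg2 h m)
  set C : ℝ := ((1 + eLpNorm g 2 volume) ^ (m + 1)).toReal with hC
  have hlim := (h1.mul_const C).add (h2.const_mul (eLpNorm g 2 volume).toReal)
  rw [zero_mul, mul_zero, add_zero] at hlim
  refine squeeze_zero' (Eventually.of_forall fun _ => norm_nonneg _) ?_ hlim
  filter_upwards [tendsto_eLpNorm_of_sub hf2 hg2 h] with n hn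
  have hp := fun n => (hf n).kernelPow m
  have hp2 := fun n => MemLp.kernelPow (hf n) (hf2 n) m
  have hq := hg.kernelPow m
  have hq2 := MemLp.kernelPow hg hg2 m
  rw [kernelTrace_sub (hp n) hq (hf2 n) (hp2 n) hg2 hq2]
  refine (norm_add_le _ _).trans (add_le_add ?_ ?_)
  · refine (abs_kernelTrace_le ((hf n).sub hg) (hp n) ((hf2 n).sub hg2) (hp2 n)).trans ?_
    refine mul_le_mul_of_nonneg_left (ENNReal.toReal_mono ?_ ?_) ENNReal.toReal_nonneg
    · exact ENNReal.pow_ne_top (by finiteness [hg2.2.ne])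
    · exact (eLpNorm_kernelPow_le (hf n) m).trans (pow_le_pow_left₀ zero_le hn _)
  · exact abs_kernelTrace_le hg ((hp n).sub hq) hg2 ((hp2 n).sub hq2)

end KernelPow

/-! ### Traces of powers of step kernels -/

lemma Matrix.trace_mul_pow_comm {ι : Type*} [Fintype ι] [DecidableEq ι] (A B : Matrix ι ι ℝ)
    (m : ℕ) : ((A * B) ^ m).trace = ((B * A) ^ m).trace := by
  cases m with
  | zero => simp
  | succ m =>
    have h : (A * B) ^ m * A = A * (B * A) ^ m := by
      induction m with
      | zero => simp
      | succ m ih => rw [pow_succ', mul_assoc, ih, pow_succ']; simp only [mul_assoc]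
    rw [pow_succ, ← mul_assoc, h, Matrix.trace_mul_comm, ← mul_assoc, ← pow_succ']

lemma kernelTrace_eq_integral_kernelComp {F G : ℝ × ℝ → ℝ}
    (hG : StronglyMeasurable G) (hF2 : MemLp F 2 volume) (hG2 : MemLp G 2 volume) :
    kernelTrace F G = ∫ x, kernelComp F G (x, x) := by
  have h := integrable_mul_comp_swap hG hF2 hG2
  rw [Measure.volume_eq_prod] at h
  rw [kernelTrace, Measure.volume_eq_prod, integral_prod _ h]
  rfl

namespace OffDiagElementary

variable (S : OffDiagElementary)

/-- The step kernel with coefficients `c` on the cells `A i ×ˢ A j` of `S`. -/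
noncomputable def stepKernel (c : Matrix (Fin S.n) (Fin S.n) ℝ) (x : ℝ × ℝ) : ℝ :=
  ∑ i, ∑ j, c i j * ((S.A i).indicator 1 x.1 * (S.A j).indicator 1 x.2)

/-- The diagonal matrix of the measures of the `A i`. -/
noncomputable def volMatrix : Matrix (Fin S.n) (Fin S.n) ℝ :=
  Matrix.diagonal fun i => volume.real (S.A i)

lemma integral_indicator_mul (j k : Fin S.n) :
    ∫ y, (S.A j).indicator (1 : ℝ → ℝ) y * (S.A k).indicator (1 : ℝ → ℝ) y = S.volMatrix j k := by
  rw [← inner_cell_cell, volMatrix]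
  rcases eq_or_ne j k with rfl | h
  · rw [inner_cell_self, Matrix.diagonal_apply_eq]
  · rw [inner_cell_of_ne S h, Matrix.diagonal_apply_ne _ h]

lemma measurable_stepKernel (c : Matrix (Fin S.n) (Fin S.n) ℝ) : Measurable (S.stepKernel c) := by
  unfold stepKernel
  refine Finset.measurable_sum _ fun i _ => Finset.measurable_sum _ fun j _ => ?_
  exact measurable_const.mul
    (((measurable_one.indicator (S.measurableSet i)).comp measurable_fst).mul
    ((measurable_one.indicator (S.measurableSet j)).comp measurable_snd))

lemma memLp_stepKernel (c : Matrix (Fin S.n) (Fin S.n) ℝ) (p : ENNReal) :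
    MemLp (S.stepKernel c) p (volume : Measure (ℝ × ℝ)) := by
  unfold stepKernel
  refine memLp_finsetSum _ fun i _ => memLp_finsetSum _ fun j _ => MemLp.const_mul ?_ _
  rw [indicator_mul_indicator_eq]
  refine memLp_indicator_const p ((S.measurableSet i).prod (S.measurableSet j)) _ (Or.inr ?_)
  rw [Measure.volume_eq_prod, Measure.prod_prod]
  exact ENNReal.mul_ne_top (S.volume_ne_top i) (S.volume_ne_top j)

lemma kernelComp_stepKernel (c c' : Matrix (Fin S.n) (Fin S.n) ℝ) :
    kernelComp (S.stepKernel c) (S.stepKernel c') = S.stepKernel (c * S.volMatrix * c') := by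
  ext p
  have h : ∀ y, S.stepKernel c (p.1, y) * S.stepKernel c' (y, p.2) = ∑ i, ∑ j, ∑ k, ∑ l,
      (c i j * c' k l * ((S.A i).indicator (1 : ℝ → ℝ) p.1 * (S.A l).indicator (1 : ℝ → ℝ) p.2)) *
      ((S.A j).indicator (1 : ℝ → ℝ) y * (S.A k).indicator (1 : ℝ → ℝ) y) := by
    intro y
    simp only [stepKernel, sum_sum_mul_sum_sum]
    exact Finset.sum_congr rfl fun i _ => Finset.sum_congr rfl fun j _ =>
      Finset.sum_congr rfl fun k _ => Finset.sum_congr rfl fun l _ => by ring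
  rw [kernelComp]
  simp_rw [h]
  rw [integral_sum_four fun i j k l => (integrable_indicator_mul S S j k).const_mul _]
  simp_rw [integral_const_mul, integral_indicator_mul]
  refine Finset.sum_congr rfl fun i _ => ?_
  simp_rw [Matrix.mul_apply, Finset.sum_mul]
  rw [Finset.sum_comm]
  rw [Finset.sum_congr rfl fun k _ => Finset.sum_comm, Finset.sum_comm]
  exact Finset.sum_congr rfl fun l _ => Finset.sum_congr rfl fun k _ =>
    Finset.sum_congr rfl fun j _ => by ring

lemma kernelPow_stepKernel (c : Matrix (Fin S.n) (Fin S.n) ℝ) (n : ℕ) :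
    kernelPow (S.stepKernel c) n = S.stepKernel ((c * S.volMatrix) ^ n * c) := by
  induction n with
  | zero => simp [kernelPow]
  | succ n ih =>
    rw [kernelPow, ih, kernelComp_stepKernel, pow_succ' (c * S.volMatrix) n]
    simp only [mul_assoc]

lemma kernelTrace_stepKernel (c c' : Matrix (Fin S.n) (Fin S.n) ℝ) :
    kernelTrace (S.stepKernel c) (S.stepKernel c') =
      (c * S.volMatrix * c' * S.volMatrix).trace := by
  rw [kernelTrace_eq_integral_kernelComp (S.measurable_stepKernel c').stronglyMeasurable
    (S.memLp_stepKernel c 2) (S.memLp_stepKernel c' 2), kernelComp_stepKernel]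
  have hint := fun i l => (integrable_indicator_mul S S i l).const_mul
    ((c * S.volMatrix * c') i l)
  simp only [stepKernel, Matrix.trace, Matrix.diag_apply]
  rw [integral_finsetSum _ fun i _ => integrable_finsetSum _ fun l _ => hint i l]
  refine Finset.sum_congr rfl fun i _ => ?_
  rw [integral_finsetSum _ fun l _ => hint i l, Matrix.mul_apply]
  refine Finset.sum_congr rfl fun l _ => ?_
  rw [integral_const_mul, integral_indicator_mul]
  congr 1
  rcases eq_or_ne i l with rfl | h
  · rfl
  · rw [volMatrix, Matrix.diagonal_apply_ne _ h, Matrix.diagonal_apply_ne _ h.symm]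

/-- The symmetrized coefficients of `S`. -/
noncomputable def symmCoeff : Matrix (Fin S.n) (Fin S.n) ℝ :=
  Matrix.of fun i j => (S.c i j + S.c j i) / 2

/-- The symmetrization of the elementary function `S`. -/
noncomputable def symmKernel (x : ℝ × ℝ) : ℝ := (S.toFun x + S.toFun x.swap) / 2

lemma symmKernel_eq_stepKernel :
    S.symmKernel = S.stepKernel S.symmCoeff := by
  ext x
  have h : S.toFun x.swap = ∑ i, ∑ j, S.c j i *
      ((S.A i).indicator (1 : ℝ → ℝ) x.1 * (S.A j).indicator (1 : ℝ → ℝ) x.2) := by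
    rw [toFun, Finset.sum_comm]
    exact Finset.sum_congr rfl fun i _ => Finset.sum_congr rfl fun j _ => by
      rw [Prod.fst_swap, Prod.snd_swap, mul_comm ((S.A j).indicator _ _)]
  rw [symmKernel, h]
  simp only [toFun, stepKernel, symmCoeff, Matrix.of_apply]
  rw [← Finset.sum_add_distrib, Finset.sum_div]
  refine Finset.sum_congr rfl fun i _ => ?_
  rw [← Finset.sum_add_distrib, Finset.sum_div]
  exact Finset.sum_congr rfl fun j _ => by ring

lemma stronglyMeasurable_symmKernel : StronglyMeasurable S.symmKernel := by
  rw [symmKernel_eq_stepKernel]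
  exact (S.measurable_stepKernel _).stronglyMeasurable

lemma memLp_symmKernel : MemLp S.symmKernel 2 volume := by
  rw [symmKernel_eq_stepKernel]
  exact S.memLp_stepKernel _ 2

lemma trace_symmMatrix_pow (n : ℕ) :
    (S.symmMatrix ^ (n + 2)).trace = kernelTrace S.symmKernel (kernelPow S.symmKernel n) := by
  set E : Matrix (Fin S.n) (Fin S.n) ℝ := Matrix.diagonal fun i => √(volume.real (S.A i)) with hE
  have hD : E * E = S.volMatrix := by
    rw [hE, Matrix.diagonal_mul_diagonal, volMatrix]
    congr 1
    ext i
    exact Real.mul_self_sqrt measureReal_nonneg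
  have hM : S.symmMatrix = E * (S.symmCoeff * E) := by
    ext i j
    rw [hE, Matrix.diagonal_mul, Matrix.mul_diagonal]
    simp only [symmMatrix, symmCoeff, Matrix.of_apply]
    ring
  rw [hM, Matrix.trace_mul_pow_comm, mul_assoc, hD, symmKernel_eq_stepKernel, kernelPow_stepKernel,
    kernelTrace_stepKernel]
  congr 1
  rw [pow_succ', pow_succ]
  simp only [mul_assoc]

lemma eLpNorm_symmKernel_sub_le {f : ℝ × ℝ → ℝ} (hf : StronglyMeasurable f)
    (hsymm : ∀ x, f x.swap = f x) :
    eLpNorm (S.symmKernel - f) 2 volume ≤ eLpNorm (fun x => S.toFun x - f x) 2 volume := by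
  set g : ℝ × ℝ → ℝ := fun x => S.toFun x - f x with hg
  have hgm : StronglyMeasurable g := S.measurable_toFun.stronglyMeasurable.sub hf
  have h1 : S.symmKernel - f = (1 / 2 : ℝ) • (g + fun x => g x.swap) := by
    ext x
    simp only [symmKernel, hg, Pi.sub_apply, Pi.smul_apply, Pi.add_apply, smul_eq_mul, hsymm]
    ring
  rw [h1, eLpNorm_const_smul]
  calc _ ≤ ‖(1 / 2 : ℝ)‖ₑ * (eLpNorm g 2 volume + eLpNorm g 2 volume) := by
        refine mul_le_mul_right ?_ _
        refine (eLpNorm_add_le hgm.aestronglyMeasurable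
          (hgm.comp_measurable measurable_swap).aestronglyMeasurable (by norm_num)).trans_eq ?_
        exact congrArg _ (eLpNorm_comp_swap hgm)
    _ = eLpNorm g 2 volume := by
        rw [← two_mul, ← mul_assoc]
        have : ‖(1 / 2 : ℝ)‖ₑ * 2 = 1 := by
          rw [Real.enorm_eq_ofReal (by norm_num), ← ENNReal.ofReal_ofNat 2,
            ← ENNReal.ofReal_mul (by norm_num)]
          norm_num
        rw [this, one_mul]

end OffDiagElementary

/-! ### The cumulant generating function of a double Wiener-Itô integral -/

lemma abs_exp_sub_exp_le (a b : ℝ) :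
    |Real.exp a - Real.exp b| ≤ |a - b| * (Real.exp a + Real.exp b) := by
  have key : ∀ a b : ℝ, Real.exp a - Real.exp b ≤ (a - b) * Real.exp a := by
    intro a b
    have h := mul_le_mul_of_nonneg_left (Real.add_one_le_exp (b - a)) (Real.exp_pos a).le
    rw [← Real.exp_add, add_sub_cancel] at h
    linarith
  have ha := Real.exp_pos a
  have hb := Real.exp_pos b
  have h1 := le_abs_self (a - b)
  have h2 := neg_abs_le (a - b)
  rw [abs_le]
  constructor
  · have := key b a
    nlinarith
  · have := key a b
    nlinarith

section Convergence

variable {Ω : Type*} [MeasurableSpace Ω] {P : Measure Ω}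
  {X : Ω → ℝ} {Y : ℕ → Ω → ℝ}

lemma integrable_exp_of_tendsto (hX : MemLp X 2 P) (hY : ∀ n, MemLp (Y n) 2 P)
    (h : Tendsto (fun n => eLpNorm (fun ω => Y n ω - X ω) 2 P) atTop (𝓝 0)) {θ C : ℝ}
    (hC : ∀ᶠ n in atTop, Integrable (fun ω => Real.exp (θ * Y n ω)) P ∧
      ∫ ω, Real.exp (θ * Y n ω) ∂P ≤ C) :
    Integrable (fun ω => Real.exp (θ * X ω)) P := by
  have hm := tendstoInMeasure_of_tendsto_eLpNorm two_ne_zero (fun n => (hY n).1) hX.1 h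
  obtain ⟨ns, hns, hae⟩ := hm.exists_seq_tendsto_ae
  have hmeas : AEStronglyMeasurable (fun ω => Real.exp (θ * X ω)) P :=
    Real.continuous_exp.comp_aestronglyMeasurable (hX.1.const_mul θ)
  refine ⟨hmeas, ?_⟩
  rw [hasFiniteIntegral_iff_enorm]
  have h1 : ∫⁻ ω, ‖Real.exp (θ * X ω)‖ₑ ∂P ≤
      liminf (fun n => ∫⁻ ω, ‖Real.exp (θ * Y (ns n) ω)‖ₑ ∂P) atTop := by
    refine le_trans (lintegral_mono_ae ?_) (lintegral_liminf_le' fun n =>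
      (Real.continuous_exp.comp_aestronglyMeasurable ((hY (ns n)).1.const_mul θ)).enorm)
    filter_upwards [hae] with ω hω
    have : Tendsto (fun n => ‖Real.exp (θ * Y (ns n) ω)‖ₑ) atTop (𝓝 ‖Real.exp (θ * X ω)‖ₑ) :=
      (continuous_enorm.comp (Real.continuous_exp.comp (continuous_const.mul continuous_id))).tendsto
        (X ω) |>.comp hω
    exact this.liminf_eq.ge
  refine (h1.trans (liminf_le_of_frequently_le' (Eventually.frequently ?_))).trans_lt
    (ENNReal.ofReal_lt_top (r := C))
  filter_upwards [hns.tendsto_atTop.eventually hC] with n hn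
  have : ∀ ω, ‖Real.exp (θ * Y (ns n) ω)‖ₑ = ENNReal.ofReal (Real.exp (θ * Y (ns n) ω)) :=
    fun ω => Real.enorm_eq_ofReal (Real.exp_pos _).le
  simp_rw [this]
  rw [← ofReal_integral_eq_lintegral_ofReal hn.1
    (Eventually.of_forall fun _ => (Real.exp_pos _).le)]
  exact ENNReal.ofReal_le_ofReal hn.2

/-- Convergence in `L²` implies convergence of the moment generating functions at `θ` as soon as
those at `2θ` are bounded. -/
lemma tendsto_integral_exp [IsProbabilityMeasure P] (hX : MemLp X 2 P) (hY : ∀ n, MemLp (Y n) 2 P)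
    (h : Tendsto (fun n => eLpNorm (fun ω => Y n ω - X ω) 2 P) atTop (𝓝 0)) {θ C : ℝ}
    (hC : ∀ᶠ n in atTop, Integrable (fun ω => Real.exp (2 * θ * Y n ω)) P ∧
      ∫ ω, Real.exp (2 * θ * Y n ω) ∂P ≤ C) :
    Integrable (fun ω => Real.exp (θ * X ω)) P ∧
      Tendsto (fun n => ∫ ω, Real.exp (θ * Y n ω) ∂P) atTop
        (𝓝 (∫ ω, Real.exp (θ * X ω) ∂P)) := by
  have h2X := integrable_exp_of_tendsto hX hY h hC
  have hL2 : ∀ U : Ω → ℝ, MemLp U 2 P → Integrable (fun ω => Real.exp (2 * θ * U ω)) P →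
      MemLp (fun ω => Real.exp (θ * U ω)) 2 P ∧
      eLpNorm (fun ω => Real.exp (θ * U ω)) 2 P ^ 2 =
        ENNReal.ofReal (∫ ω, Real.exp (2 * θ * U ω) ∂P) := by
    intro U hU hI
    have hsq : ∀ ω, Real.exp (θ * U ω) ^ 2 = Real.exp (2 * θ * U ω) := fun ω => by
      rw [← Real.exp_nat_mul]; congr 1; push_cast; ring
    have hmem : MemLp (fun ω => Real.exp (θ * U ω)) 2 P := by
      rw [memLp_two_iff_integrable_sq
        (Real.continuous_exp.comp_aestronglyMeasurable (hU.1.const_mul θ))]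
      simpa only [hsq] using hI
    refine ⟨hmem, ?_⟩
    rw [← ofReal_integral_sq_eq_eLpNorm hmem]
    simp_rw [hsq]
  obtain ⟨hX2, hXn⟩ := hL2 X hX h2X
  have hXI := hX2.integrable (by norm_num)
  refine ⟨hXI, ?_⟩
  refine tendsto_integral_of_L1 _ hXI.1 ?_ ?_
  · filter_upwards [hC] with n hn
    exact (hL2 (Y n) (hY n) hn.1).1.integrable (by norm_num)
  -- by Cauchy-Schwarz the `L¹` distance of the exponentials is at most a constant times the `L²`
  -- distance of the variables
  set K : ENNReal := eLpNorm (fun ω => Real.exp (θ * X ω)) 2 P with hK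
  have hKtop : K ≠ ⊤ := hX2.2.ne
  set D : ENNReal := ENNReal.ofReal C + 1 with hD
  have hlim : Tendsto (fun n => ‖θ‖ₑ * eLpNorm (fun ω => Y n ω - X ω) 2 P * (D + K)) atTop
      (𝓝 0) := by
    have h1 := ENNReal.Tendsto.const_mul (a := ‖θ‖ₑ) h (Or.inr (by simp))
    rw [mul_zero] at h1
    have h2 := ENNReal.Tendsto.mul_const (b := D + K) h1 (Or.inr (by finiteness))
    rwa [zero_mul] at h2
  refine tendsto_of_tendsto_of_tendsto_of_le_of_le' tendsto_const_nhds hlim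
    (Eventually.of_forall fun _ => zero_le) ?_
  filter_upwards [hC] with n hn
  obtain ⟨hY2, hYn⟩ := hL2 (Y n) (hY n) hn.1
  have hle : eLpNorm (fun ω => Real.exp (θ * Y n ω)) 2 P ≤ D := by
    refine (ENNReal.pow_le_pow_left_iff two_ne_zero).1 ?_
    rw [hYn]
    refine (ENNReal.ofReal_le_ofReal hn.2).trans ?_
    have h1 : (1 : ENNReal) ≤ D := le_add_self
    calc ENNReal.ofReal C ≤ D * 1 := by rw [mul_one]; exact le_self_add
      _ ≤ D ^ 2 := by rw [sq]; exact mul_le_mul_right h1 _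
  have hdiff : AEMeasurable (fun ω => ‖θ * (Y n ω - X ω)‖ₑ) P :=
    (((hY n).sub hX).1.const_mul θ).enorm
  have hsum : AEMeasurable (fun ω => ‖Real.exp (θ * Y n ω) + Real.exp (θ * X ω)‖ₑ) P :=
    (hY2.add hX2).1.enorm
  calc _ ≤ ∫⁻ ω, ‖θ * (Y n ω - X ω)‖ₑ * ‖Real.exp (θ * Y n ω) + Real.exp (θ * X ω)‖ₑ ∂P := by
        refine lintegral_mono fun ω => ?_
        rw [← enorm_mul, enorm_le_iff_norm_le, Real.norm_eq_abs, Real.norm_eq_abs, abs_mul,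
          mul_sub, abs_of_pos (a := Real.exp _ + Real.exp _) (by positivity)]
        exact abs_exp_sub_exp_le _ _
    _ ≤ eLpNorm (fun ω => θ * (Y n ω - X ω)) 2 P *
        eLpNorm (fun ω => Real.exp (θ * Y n ω) + Real.exp (θ * X ω)) 2 P := by
        refine (ENNReal.pow_le_pow_left_iff two_ne_zero).1 ?_
        rw [mul_pow, eLpNorm_two_sq, eLpNorm_two_sq]
        exact ENNReal_sq_lintegral_mul_le hdiff hsum
    _ ≤ _ := by
        refine mul_le_mul' ?_ ?_
        · exact (eLpNorm_const_smul θ (fun ω => Y n ω - X ω) 2 P).le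
        · exact (eLpNorm_add_le hY2.1 hX2.1 (by norm_num)).trans (add_le_add hle le_rfl)

end Convergence

/-- The cumulant generating function of `I₂(f)` with `f` symmetric:
`log E[exp(θ I₂(f))] = ∑_{m ≥ 2} (2θ)^m / (2m) * tr(f^m)`. -/
lemma integral_exp_doubleWienerIntegral {Ω : Type*} [MeasurableSpace Ω] {P : Measure Ω}
    {W : Lp ℝ 2 (volume : Measure ℝ) → Ω → ℝ} (hW : IsIsonormal W P) {f : ℝ × ℝ → ℝ}
    (hf : StronglyMeasurable f) (hsymm : ∀ x, f x.swap = f x) {X : Ω → ℝ}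
    (hX : IsDoubleWienerIntegral W P f X) {r θ : ℝ} (hr : r = (1 + eLpNorm f 2 volume).toReal)
    (hθ : 4 * |θ| * r < 1) :
    Integrable (fun ω => Real.exp (θ * X ω)) P ∧
    Summable (fun n : ℕ => (2 * θ) ^ (n + 2) / (2 * (n + 2)) * kernelTrace f (kernelPow f n)) ∧
    ∫ ω, Real.exp (θ * X ω) ∂P = Real.exp (∑' n : ℕ, (2 * θ) ^ (n + 2) / (2 * (n + 2)) *
      kernelTrace f (kernelPow f n)) := by
  have hP := hW.gaussian.isProbabilityMeasure
  obtain ⟨hf2, hX2, S, hS, hI⟩ := hX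
  have hr0 : 0 ≤ r := hr ▸ ENNReal.toReal_nonneg
  have hsm := fun n => (S n).stronglyMeasurable_symmKernel
  have hs2 := fun n => (S n).memLp_symmKernel
  have hlim : Tendsto (fun n => eLpNorm ((S n).symmKernel - f) 2 volume) atTop (𝓝 0) :=
    tendsto_of_tendsto_of_tendsto_of_le_of_le tendsto_const_nhds hS (fun _ => zero_le)
      fun n => (S n).eLpNorm_symmKernel_sub_le hf hsymm
  have hnorm : ∀ᶠ n in atTop, (eLpNorm (S n).symmKernel 2 volume).toReal ≤ r := by
    filter_upwards [tendsto_eLpNorm_of_sub hs2 hf2 hlim] with n hn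
    rw [hr]
    exact ENNReal.toReal_mono (by finiteness [hf2.2.ne]) hn
  have hT : ∀ g : ℝ × ℝ → ℝ, StronglyMeasurable g → MemLp g 2 volume →
      (eLpNorm g 2 volume).toReal ≤ r → ∀ n, |kernelTrace g (kernelPow g n)| ≤ r ^ (n + 2) :=
    fun g hg hg2 hgr n => (abs_kernelTrace_kernelPow_le hg hg2 n).trans
      (pow_le_pow_left₀ ENNReal.toReal_nonneg hgr _)
  have hbound : ∀ (η : ℝ) (g : ℝ × ℝ → ℝ), StronglyMeasurable g → MemLp g 2 volume →
      (eLpNorm g 2 volume).toReal ≤ r → ∀ n : ℕ,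
      ‖(2 * η) ^ (n + 2) / (2 * (n + 2)) * kernelTrace g (kernelPow g n)‖ ≤
        (2 * |η| * r) ^ (n + 2) := by
    intro η g hg hg2 hgr n
    rw [norm_mul, norm_div, norm_pow, norm_mul, Real.norm_ofNat, mul_pow (2 * |η|)]
    refine mul_le_mul ?_ (hT g hg hg2 hgr n) (abs_nonneg _) (by positivity)
    refine div_le_self (by positivity) ?_
    rw [Real.norm_of_nonneg (by positivity)]
    have : (0 : ℝ) ≤ n := n.cast_nonneg
    linarith
  have hsummable : ∀ η : ℝ, 2 * |η| * r < 1 → Summable fun n : ℕ => (2 * |η| * r) ^ (n + 2) :=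
    fun η hη => (summable_nat_add_iff 2).2 (summable_geometric_of_lt_one (by positivity) hη)
  have hexp : ∀ η : ℝ, 2 * |η| * r < 1 → ∀ᶠ n in atTop,
      Integrable (fun ω => Real.exp (η * (S n).wienerIntegral W ω)) P ∧
      ∫ ω, Real.exp (η * (S n).wienerIntegral W ω) ∂P = Real.exp (∑' m : ℕ,
        (2 * η) ^ (m + 2) / (2 * (m + 2)) *
          kernelTrace (S n).symmKernel (kernelPow (S n).symmKernel m)) := by
    intro η hη
    filter_upwards [hnorm] with n hn
    have htr := (S n).trace_symmMatrix_pow 0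
    have h1 := (S n).exp_wienerIntegral hW hr0 (by
      rw [htr]
      exact (le_abs_self _).trans (hT _ (hsm n) (hs2 n) hn 0)) hη
    simpa only [OffDiagElementary.trace_symmMatrix_pow] using h1
  have h2θ : 2 * |2 * θ| * r < 1 := by rw [abs_mul, abs_two]; linarith
  have h1θ : 2 * |θ| * r < 1 := by
    have : 0 ≤ |θ| * r := by positivity
    linarith
  have hfr : (eLpNorm f 2 volume).toReal ≤ r := by
    rw [hr]
    exact ENNReal.toReal_mono (by finiteness [hf2.2.ne]) le_add_self
  obtain ⟨hint, htend⟩ := tendsto_integral_exp hX2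
    (fun n => OffDiagElementary.memLp_wienerIntegral hW (S n)) hI (θ := θ)
    (C := Real.exp (∑' n : ℕ, (2 * |2 * θ| * r) ^ (n + 2))) (by
      filter_upwards [hexp (2 * θ) h2θ, hnorm] with n hn hnr
      refine ⟨hn.1, hn.2.trans_le (Real.exp_le_exp.2 ?_)⟩
      exact (le_abs_self _).trans (tsum_of_norm_bounded (hsummable _ h2θ).hasSum
        (hbound (2 * θ) _ (hsm n) (hs2 n) hnr)))
  refine ⟨hint, Summable.of_norm_bounded (hsummable _ h1θ) (hbound θ f hf hf2 hfr), ?_⟩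
  refine tendsto_nhds_unique (htend.congr' ((hexp θ h1θ).mono fun n hn => hn.2)) ?_
  refine (Real.continuous_exp.tendsto _).comp ?_
  refine tendsto_tsum_of_dominated_convergence (hsummable _ h1θ) (fun m => ?_) ?_
  · exact (tendsto_kernelTrace_kernelPow hsm hf hs2 hf2 hlim m).const_mul _
  · filter_upwards [hnorm] with n hn m using hbound θ _ (hsm n) (hs2 n) hn m

/-- The moment generating function of a double Wiener-Itô integral is finite near `0`, and its
cumulants are multiples of the traces of the powers of the kernel. -/
lemma cumulant_doubleWienerIntegral {Ω : Type*} [MeasurableSpace Ω] {P : Measure Ω}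
    {W : Lp ℝ 2 (volume : Measure ℝ) → Ω → ℝ} (hW : IsIsonormal W P) {f : ℝ × ℝ → ℝ}
    (hf : StronglyMeasurable f) (hsymm : ∀ x, f x.swap = f x) {X : Ω → ℝ}
    (hX : IsDoubleWienerIntegral W P f X) :
    0 ∈ interior (integrableExpSet X P) ∧ ∀ n : ℕ, cumulant (n + 2) X P =
      2 ^ (n + 1) * (Nat.factorial (n + 1) : ℝ) * kernelTrace f (kernelPow f n) := by
  set r : ℝ := (1 + eLpNorm f 2 volume).toReal with hr
  have hev : ∀ᶠ θ in 𝓝 (0 : ℝ), 4 * |θ| * r < 1 := by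
    have : Tendsto (fun θ : ℝ => 4 * |θ| * r) (𝓝 0) (𝓝 (4 * |0| * r)) :=
      Continuous.tendsto (by fun_prop) 0
    refine this.eventually (gt_mem_nhds ?_)
    simp
  have h0 : 0 ∈ interior (integrableExpSet X P) := by
    rw [mem_interior_iff_mem_nhds]
    filter_upwards [hev] with θ hθ
    exact (integral_exp_doubleWienerIntegral hW hf hsymm hX hr hθ).1
  refine ⟨h0, fun n => ?_⟩
  set c : ℕ → ℝ := fun k => match k with
    | 0 => 0
    | 1 => 0
    | k + 2 => 2 ^ (k + 2) / (2 * (k + 2)) * kernelTrace f (kernelPow f k) with hc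
  have hps : HasFPowerSeriesAt (cgf X P) (FormalMultilinearSeries.ofScalars ℝ c) 0 := by
    rw [hasFPowerSeriesAt_iff]
    filter_upwards [hev] with θ hθ
    obtain ⟨-, hs, he⟩ := integral_exp_doubleWienerIntegral hW hf hsymm hX hr hθ
    rw [zero_add, cgf, mgf, he, Real.log_exp]
    simp_rw [FormalMultilinearSeries.coeff_ofScalars]
    rw [← hasSum_nat_add_iff' 2]
    simp only [Finset.sum_range_succ, Finset.sum_range_zero, hc, smul_zero, add_zero, sub_zero]
    refine hs.hasSum.congr_fun fun k => ?_
    rw [smul_eq_mul, mul_pow]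
    ring
  have huniq := hps.eq_formalMultilinearSeries (analyticAt_cgf h0).hasFPowerSeriesAt
  have hcoeff := congrArg (fun p => FormalMultilinearSeries.coeff p (n + 2)) huniq
  simp only [FormalMultilinearSeries.coeff_ofScalars, hc] at hcoeff
  have hfac : ((n + 2).factorial : ℝ) ≠ 0 := by positivity
  rw [eq_div_iff hfac] at hcoeff
  rw [cumulant, ← hcoeff, Nat.factorial_succ]
  push_cast
  field_simp
  ring

/-! ### The covariance of tempered powers and the Bessel function -/

/-- The integral `∫_0^∞ u^{a - 1} e^{-b u} du`, infinite for `b ≤ 0`. -/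
noncomputable def gammaLIntegral (a b : ℝ) : ENNReal :=
  ∫⁻ u in Set.Ioi (0 : ℝ), ENNReal.ofReal (u ^ (a - 1) * Real.exp (-(b * u)))

lemma gammaLIntegral_of_pos {a b : ℝ} (ha : 0 < a) (hb : 0 < b) :
    gammaLIntegral a b = ENNReal.ofReal (b ^ (-a) * Real.Gamma a) := by
  have h := Real.integral_rpow_mul_exp_neg_mul_Ioi ha hb
  have hG := Real.Gamma_pos_of_pos ha
  have hint : IntegrableOn (fun u => u ^ (a - 1) * Real.exp (-(b * u))) (Set.Ioi 0) :=
    .of_integral_ne_zero (by rw [h]; positivity)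
  rw [gammaLIntegral, ← ofReal_integral_eq_lintegral_ofReal hint, h, one_div, Real.inv_rpow hb.le,
    Real.rpow_neg hb.le]
  filter_upwards [self_mem_ae_restrict measurableSet_Ioi] with u hu
  have : 0 < u := hu
  positivity

lemma gammaLIntegral_of_nonpos {a b : ℝ} (ha : 0 < a) (hb : b ≤ 0) : gammaLIntegral a b = ⊤ := by
  have h1 : ∫⁻ u in Set.Ioi (1 : ℝ), ENNReal.ofReal (u⁻¹) = ⊤ := by
    by_contra hne
    refine not_integrableOn_Ioi_inv (a := 1) ⟨by fun_prop, ?_⟩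
    rw [hasFiniteIntegral_iff_ofReal]
    · exact lt_top_iff_ne_top.2 hne
    · filter_upwards [self_mem_ae_restrict measurableSet_Ioi] with u hu
      have : (1 : ℝ) < u := hu
      simp only [Pi.zero_apply]
      positivity
  rw [eq_top_iff, ← h1, gammaLIntegral]
  refine (setLIntegral_mono' measurableSet_Ioi fun u hu => ?_).trans
    (lintegral_mono_set (Set.Ioi_subset_Ioi zero_le_one))
  have hu1 : (1 : ℝ) < u := hu
  refine ENNReal.ofReal_le_ofReal ?_
  rw [← Real.rpow_neg_one]
  have e1 : u ^ (-1 : ℝ) ≤ u ^ (a - 1) := Real.rpow_le_rpow_of_exponent_le hu1.le (by linarith)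
  have e2 : 1 ≤ Real.exp (-(b * u)) := Real.one_le_exp (by nlinarith)
  have e3 : 0 < u ^ (a - 1) := by positivity
  nlinarith

lemma gammaLIntegral_ne_zero {a b : ℝ} (ha : 0 < a) : gammaLIntegral a b ≠ 0 := by
  rcases le_or_gt b 0 with hb | hb
  · rw [gammaLIntegral_of_nonpos ha hb]; simp
  · rw [gammaLIntegral_of_pos ha hb]
    have := Real.Gamma_pos_of_pos ha
    rw [Ne, ENNReal.ofReal_eq_zero, not_le]
    positivity

lemma lintegral_exp_mul_gaussianPDF (θ : ℝ) {v : NNReal} (hv : v ≠ 0) :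
    ∫⁻ r, ENNReal.ofReal (Real.exp (θ * r)) * gaussianPDF 0 v r =
      ENNReal.ofReal (Real.exp (v * θ ^ 2 / 2)) := by
  have h1 : ∫⁻ r, ENNReal.ofReal (Real.exp (θ * r)) ∂(gaussianReal 0 v) =
      ∫⁻ r, ENNReal.ofReal (Real.exp (θ * r)) * gaussianPDF 0 v r := by
    rw [gaussianReal_of_var_ne_zero 0 hv, lintegral_withDensity_eq_lintegral_mul _
      (measurable_gaussianPDF 0 v) (by fun_prop)]
    simp only [Pi.mul_apply, mul_comm]
  have h2 := congrFun (mgf_fun_id_gaussianReal (μ := 0) (v := v)) θ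
  rw [← h1, ← ofReal_integral_eq_lintegral_ofReal (integrable_exp_mul_gaussianReal θ)
    (Eventually.of_forall fun _ => (Real.exp_pos _).le)]
  rw [mgf] at h2
  rw [h2]
  simp

/-- Finite measures on `ℝ` with the same two-sided Laplace transform, finite near `0`, agree. -/
lemma Measure_ext_of_lintegral_exp {μ ν : Measure ℝ} {δ : ℝ} (hδ : 0 < δ)
    (h : ∀ θ : ℝ, ∫⁻ x, ENNReal.ofReal (Real.exp (θ * x)) ∂μ =
      ∫⁻ x, ENNReal.ofReal (Real.exp (θ * x)) ∂ν)
    (hfin : ∀ θ : ℝ, |θ| < δ → ∫⁻ x, ENNReal.ofReal (Real.exp (θ * x)) ∂μ ≠ ⊤) : μ = ν := by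
  have h0 := h 0
  have hf0 := hfin 0 (by simpa using hδ)
  simp only [zero_mul, Real.exp_zero, ENNReal.ofReal_one, lintegral_one] at h0 hf0
  have : IsFiniteMeasure μ := ⟨lt_top_iff_ne_top.2 hf0⟩
  have : IsFiniteMeasure ν := ⟨lt_top_iff_ne_top.2 (h0 ▸ hf0)⟩
  have hmgf : mgf id μ = mgf id ν := by
    ext θ
    simp only [mgf, id_eq]
    rw [integral_eq_lintegral_of_nonneg_ae (Eventually.of_forall fun _ => (Real.exp_pos _).le)
      (by fun_prop), integral_eq_lintegral_of_nonneg_ae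
      (Eventually.of_forall fun _ => (Real.exp_pos _).le) (by fun_prop), h]
  have hint : (0 : ℝ) ∈ interior (integrableExpSet id μ) := by
    rw [mem_interior_iff_mem_nhds]
    filter_upwards [Ioo_mem_nhds (neg_lt_zero.2 hδ) hδ] with θ hθ
    refine ⟨by fun_prop, ?_⟩
    rw [hasFiniteIntegral_iff_ofReal (Eventually.of_forall fun _ => (Real.exp_pos _).le)]
    exact lt_top_iff_ne_top.2 (hfin θ (abs_lt.2 hθ))
  refine Measure.ext_of_charFun (funext fun t => ?_)
  rw [← complexMGF_id_mul_I, ← complexMGF_id_mul_I]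
  refine eqOn_complexMGF_of_mgf' hmgf ?_ ?_
  · rw [← Measure.measure_univ_eq_zero, ← Measure.measure_univ_eq_zero, h0]
  · simpa using hint

lemma measurable_temperedPower (d lam : ℝ) : Measurable (temperedPower d lam) := by
  unfold temperedPower
  exact Measurable.ite measurableSet_Ioi (by fun_prop) measurable_const

lemma temperedPower_nonneg (d lam u : ℝ) : 0 ≤ temperedPower d lam u := by
  unfold temperedPower
  split_ifs
  · positivity
  · exact le_rfl

/-- `temperedPower` with values in `[0, ∞]`. -/
noncomputable def temperedPowerE (d lam u : ℝ) : ENNReal := ENNReal.ofReal (temperedPower d lam u)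

@[fun_prop]
lemma measurable_temperedPowerE (d lam : ℝ) : Measurable (temperedPowerE d lam) :=
  (measurable_temperedPower d lam).ennreal_ofReal

lemma lintegral_exp_mul_temperedPowerE (d lam θ : ℝ) :
    ∫⁻ u, ENNReal.ofReal (Real.exp (θ * u)) * temperedPowerE d lam u =
      gammaLIntegral d (lam - θ) := by
  rw [gammaLIntegral, ← lintegral_indicator measurableSet_Ioi]
  refine lintegral_congr fun u => ?_
  rw [temperedPowerE, temperedPower, Set.indicator_apply]
  simp only [Set.mem_Ioi]
  split_ifs
  · rw [← ENNReal.ofReal_mul (Real.exp_pos _).le, ← mul_assoc, ← Real.exp_add, mul_comm]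
    ring_nf
  · simp

/-- The covariance `r ↦ ∫ g(x) g(x + r) dx` of the tempered power `g`. -/
noncomputable def temperedCov (d lam r : ℝ) : ENNReal :=
  ∫⁻ x, temperedPowerE d lam x * temperedPowerE d lam (x + r)

@[fun_prop]
lemma measurable_temperedCov (d lam : ℝ) : Measurable (temperedCov d lam) := by
  have hg := measurable_temperedPowerE d lam
  exact Measurable.lintegral_prod_right' (f := fun p : ℝ × ℝ =>
    temperedPowerE d lam p.2 * temperedPowerE d lam (p.2 + p.1))
    ((hg.comp measurable_snd).mul (hg.comp (measurable_snd.add measurable_fst)))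

/-- The two-sided Laplace transform of `temperedCov`, in which the two factors separate. -/
lemma lintegral_exp_mul_temperedCov (d lam θ : ℝ) :
    ∫⁻ r, ENNReal.ofReal (Real.exp (θ * r)) * temperedCov d lam r =
      gammaLIntegral d (lam + θ) * gammaLIntegral d (lam - θ) := by
  have hg := measurable_temperedPowerE d lam
  have he : ∀ θ : ℝ, Measurable fun u : ℝ => ENNReal.ofReal (Real.exp (θ * u)) := by fun_prop
  calc _ = ∫⁻ r, ∫⁻ x, ENNReal.ofReal (Real.exp (θ * r)) *
        (temperedPowerE d lam x * temperedPowerE d lam (x + r)) := by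
        refine lintegral_congr fun r => ?_
        rw [temperedCov, lintegral_const_mul _ (by fun_prop)]
    _ = ∫⁻ x, ∫⁻ r, ENNReal.ofReal (Real.exp (θ * r)) *
        (temperedPowerE d lam x * temperedPowerE d lam (x + r)) := by
        refine lintegral_lintegral_swap (Measurable.aemeasurable ?_)
        exact ((he θ).comp measurable_fst).mul ((hg.comp measurable_snd).mul
          (hg.comp (measurable_snd.add measurable_fst)))
    _ = ∫⁻ x, (ENNReal.ofReal (Real.exp (-θ * x)) * temperedPowerE d lam x) *
        ∫⁻ r, ENNReal.ofReal (Real.exp (θ * r)) * temperedPowerE d lam r := by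
        refine lintegral_congr fun x => ?_
        rw [← lintegral_const_mul _ (by fun_prop), ← lintegral_add_left_eq_self
          (fun r => ENNReal.ofReal (Real.exp (-θ * x)) * temperedPowerE d lam x *
            (ENNReal.ofReal (Real.exp (θ * r)) * temperedPowerE d lam r)) x]
        refine lintegral_congr fun r => ?_
        have : ENNReal.ofReal (Real.exp (θ * r)) =
            ENNReal.ofReal (Real.exp (-θ * x)) * ENNReal.ofReal (Real.exp (θ * (x + r))) := by
          rw [← ENNReal.ofReal_mul (Real.exp_pos _).le, ← Real.exp_add]
          ring_nf
        rw [this]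
        ring
    _ = _ := by
        rw [lintegral_mul_const _ (by fun_prop), lintegral_exp_mul_temperedPowerE,
          lintegral_exp_mul_temperedPowerE, sub_neg_eq_add]

/-- The mixture of centered Gaussian densities of variance `2 y` with mixing density
`Γ(d) y^{d - 1} e^{-λ² y}`. -/
noncomputable def gaussianMixture (d lam r : ℝ) : ENNReal :=
  ENNReal.ofReal (Real.Gamma d) * ∫⁻ y in Set.Ioi (0 : ℝ),
    ENNReal.ofReal (y ^ (d - 1) * Real.exp (-(lam ^ 2 * y))) * gaussianPDF 0 (2 * y).toNNReal r

lemma measurable_gaussianMixture_integrand (d lam : ℝ) :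
    Measurable fun p : ℝ × ℝ => ENNReal.ofReal (p.2 ^ (d - 1) * Real.exp (-(lam ^ 2 * p.2))) *
      gaussianPDF 0 (2 * p.2).toNNReal p.1 := by
  have h1 : Measurable fun p : ℝ × ℝ =>
      ENNReal.ofReal (p.2 ^ (d - 1) * Real.exp (-(lam ^ 2 * p.2))) := by fun_prop
  have h3 : Measurable fun p : ℝ × ℝ => ((0 : ℝ), (2 * p.2).toNNReal, p.1) := by fun_prop
  have h2 : Measurable fun p : ℝ × ℝ => gaussianPDF 0 (2 * p.2).toNNReal p.1 :=
    measurable_uncurry_gaussianPDF.comp h3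
  exact h1.mul h2

@[fun_prop]
lemma measurable_gaussianMixture (d lam : ℝ) : Measurable (gaussianMixture d lam) :=
  (Measurable.lintegral_prod_right' (measurable_gaussianMixture_integrand d lam)).const_mul _

lemma lintegral_exp_mul_gaussianMixture (d lam θ : ℝ) :
    ∫⁻ r, ENNReal.ofReal (Real.exp (θ * r)) * gaussianMixture d lam r =
      ENNReal.ofReal (Real.Gamma d) * gammaLIntegral d (lam ^ 2 - θ ^ 2) := by
  have hm := measurable_gaussianMixture_integrand d lam
  have he : Measurable fun p : ℝ × ℝ => ENNReal.ofReal (Real.exp (θ * p.1)) := by fun_prop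
  simp only [gaussianMixture, mul_left_comm _ (ENNReal.ofReal (Real.Gamma d))]
  rw [lintegral_const_mul]
  swap
  · exact (show Measurable fun r : ℝ => ENNReal.ofReal (Real.exp (θ * r)) by fun_prop).mul
      (Measurable.lintegral_prod_right' hm)
  congr 1
  calc _ = ∫⁻ r, ∫⁻ y in Set.Ioi (0 : ℝ), ENNReal.ofReal (Real.exp (θ * r)) *
        (ENNReal.ofReal (y ^ (d - 1) * Real.exp (-(lam ^ 2 * y))) *
          gaussianPDF 0 (2 * y).toNNReal r) := by
        refine lintegral_congr fun r => ?_
        exact (lintegral_const_mul _ (hm.comp (by fun_prop : Measurable fun y : ℝ => (r, y)))).symm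
    _ = ∫⁻ y in Set.Ioi (0 : ℝ), ∫⁻ r, ENNReal.ofReal (Real.exp (θ * r)) *
        (ENNReal.ofReal (y ^ (d - 1) * Real.exp (-(lam ^ 2 * y))) *
          gaussianPDF 0 (2 * y).toNNReal r) :=
        lintegral_lintegral_swap (he.mul hm).aemeasurable
    _ = _ := by
        refine setLIntegral_congr_fun measurableSet_Ioi fun y hy => ?_
        have hy0 : (0 : ℝ) < y := hy
        have hv : (2 * y).toNNReal ≠ 0 := by
          rw [Ne, Real.toNNReal_eq_zero, not_le]
          linarith
        simp only [mul_left_comm (ENNReal.ofReal (Real.exp (θ * _)))]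
        rw [lintegral_const_mul _ (by fun_prop (disch := measurability)),
          lintegral_exp_mul_gaussianPDF θ hv, ← ENNReal.ofReal_mul (by positivity),
          Real.coe_toNNReal _ (by linarith), mul_assoc, ← Real.exp_add]
        ring_nf

/-- Both sides have the Laplace transform `Γ(d)² (λ² - θ²)^{-d}` for `|θ| < λ`, and an infinite one
otherwise. -/
lemma temperedCov_ae_eq_gaussianMixture {d lam : ℝ} (hd : 0 < d) (hlam : 0 < lam) :
    temperedCov d lam =ᵐ[volume] gaussianMixture d lam ∧
      ∫⁻ r, temperedCov d lam r ≠ ⊤ := by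
  have hG := Real.Gamma_pos_of_pos hd
  have hL : ∀ θ : ℝ, gammaLIntegral d (lam + θ) * gammaLIntegral d (lam - θ) =
      ENNReal.ofReal (Real.Gamma d) * gammaLIntegral d (lam ^ 2 - θ ^ 2) := by
    intro θ
    have hfac : lam ^ 2 - θ ^ 2 = (lam + θ) * (lam - θ) := by ring
    rcases le_or_gt (lam + θ) 0 with h1 | h1
    · have : lam ^ 2 - θ ^ 2 ≤ 0 := by nlinarith
      rw [gammaLIntegral_of_nonpos hd h1, gammaLIntegral_of_nonpos hd this,
        ENNReal.top_mul (gammaLIntegral_ne_zero hd), ENNReal.mul_top (by simpa using hG)]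
    rcases le_or_gt (lam - θ) 0 with h2 | h2
    · have : lam ^ 2 - θ ^ 2 ≤ 0 := by nlinarith
      rw [gammaLIntegral_of_nonpos hd h2, gammaLIntegral_of_nonpos hd this,
        ENNReal.mul_top (gammaLIntegral_ne_zero hd), ENNReal.mul_top (by simpa using hG)]
    · rw [hfac, gammaLIntegral_of_pos hd h1, gammaLIntegral_of_pos hd h2,
        gammaLIntegral_of_pos hd (mul_pos h1 h2), ← ENNReal.ofReal_mul (by positivity),
        ← ENNReal.ofReal_mul hG.le, Real.mul_rpow h1.le h2.le]
      ring_nf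
  have hc := measurable_temperedCov d lam
  have hm := measurable_gaussianMixture d lam
  have hfin : ∀ θ : ℝ, |θ| < lam →
      ∫⁻ r, ENNReal.ofReal (Real.exp (θ * r)) * temperedCov d lam r ≠ ⊤ := by
    intro θ hθ
    obtain ⟨h1, h2⟩ := abs_lt.1 hθ
    rw [lintegral_exp_mul_temperedCov, gammaLIntegral_of_pos hd (by linarith),
      gammaLIntegral_of_pos hd (by linarith)]
    finiteness
  have h0 : ∫⁻ r, temperedCov d lam r ≠ ⊤ := by simpa using hfin 0 (by simpa using hlam)
  have hdens : ∀ (ρ : ℝ → ENNReal), Measurable ρ → ∀ θ : ℝ,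
      ∫⁻ r, ENNReal.ofReal (Real.exp (θ * r)) ∂(volume.withDensity ρ) =
        ∫⁻ r, ENNReal.ofReal (Real.exp (θ * r)) * ρ r := by
    intro ρ hρ θ
    rw [lintegral_withDensity_eq_lintegral_mul _ hρ (by fun_prop)]
    simp only [Pi.mul_apply, mul_comm]
  refine ⟨(withDensity_eq_iff hc.aemeasurable hm.aemeasurable h0).1
    (Measure_ext_of_lintegral_exp hlam (fun θ => ?_) fun θ hθ => ?_), h0⟩
  · rw [hdens _ hc, hdens _ hm, lintegral_exp_mul_temperedCov,
      lintegral_exp_mul_gaussianMixture, hL]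
  · rw [hdens _ hc]
    exact hfin θ hθ

/-- The logarithmic substitution `y = κ e^u`. -/
lemma setLIntegral_Ioi_eq_lintegral_mul_exp {κ : ℝ} (hκ : 0 < κ) (f : ℝ → ENNReal) :
    ∫⁻ y in Set.Ioi (0 : ℝ), f y =
      ∫⁻ u, ENNReal.ofReal (κ * Real.exp u) * f (κ * Real.exp u) := by
  have himg : (fun u => κ * Real.exp u) '' Set.univ = Set.Ioi 0 := by
    ext y
    simp only [Set.image_univ, Set.mem_range, Set.mem_Ioi]
    constructor
    · rintro ⟨u, rfl⟩
      positivity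
    · intro hy
      refine ⟨Real.log (y / κ), ?_⟩
      rw [Real.exp_log (by positivity)]
      field_simp
  have hinj : Set.InjOn (fun u => κ * Real.exp u) Set.univ := fun u _ v _ h =>
    Real.exp_injective (mul_left_cancel₀ hκ.ne' h)
  rw [← himg, lintegral_image_eq_lintegral_abs_deriv_mul MeasurableSet.univ
    (fun u _ => ((Real.hasDerivAt_exp u).const_mul κ).hasDerivWithinAt) hinj, setLIntegral_univ]
  refine lintegral_congr fun u => ?_
  rw [abs_of_pos (by positivity)]

/-- Folding an integral over `ℝ` onto the half-line. -/
lemma lintegral_exp_mul_even (a : ℝ) {E : ℝ → ℝ} (hE : Measurable E) (hE0 : ∀ u, 0 ≤ E u)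
    (heven : ∀ u, E (-u) = E u) :
    ∫⁻ u, ENNReal.ofReal (Real.exp (a * u) * E u) =
      2 * ∫⁻ u in Set.Ioi (0 : ℝ), ENNReal.ofReal (E u * Real.cosh (a * u)) := by
  have h1 : ∫⁻ u in Set.Iio (0 : ℝ), ENNReal.ofReal (Real.exp (a * u) * E u) =
      ∫⁻ u in Set.Ioi (0 : ℝ), ENNReal.ofReal (Real.exp (-(a * u)) * E u) := by
    rw [← lintegral_indicator measurableSet_Iio, ← lintegral_indicator measurableSet_Ioi,
      ← lintegral_neg_eq_self]
    refine lintegral_congr fun u => ?_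
    simp only [Set.indicator_apply, Set.mem_Iio, Set.mem_Ioi, Left.neg_neg_iff, heven, mul_neg]
  rw [← lintegral_add_compl _ (measurableSet_Ioi (a := (0 : ℝ))), Set.compl_Ioi,
    setLIntegral_congr Iio_ae_eq_Iic.symm, h1, ← lintegral_add_left (by fun_prop),
    ← lintegral_const_mul _ (by fun_prop)]
  refine lintegral_congr fun u => ?_
  have := hE0 u
  rw [← ENNReal.ofReal_add (by positivity) (by positivity),
    show (2 : ENNReal) = ENNReal.ofReal 2 by simp, ← ENNReal.ofReal_mul (by norm_num),
    Real.cosh_eq]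
  ring_nf

lemma gaussianMixture_integrand_eq (d lam r : ℝ) {y : ℝ} (hy : 0 < y) :
    ENNReal.ofReal (y ^ (d - 1) * Real.exp (-(lam ^ 2 * y))) * gaussianPDF 0 (2 * y).toNNReal r =
      ENNReal.ofReal ((Real.sqrt (4 * Real.pi))⁻¹ * y ^ (d - 1 / 2 - 1) *
        Real.exp (-(lam ^ 2 * y)) * Real.exp (-(r ^ 2 / (4 * y)))) := by
  rw [gaussianPDF, gaussianPDFReal, ← ENNReal.ofReal_mul (by positivity),
    Real.coe_toNNReal _ (by positivity)]
  congr 1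
  have h1 : Real.sqrt (2 * Real.pi * (2 * y)) = Real.sqrt (4 * Real.pi) * y ^ (1 / 2 : ℝ) := by
    rw [← Real.sqrt_eq_rpow, ← Real.sqrt_mul (by positivity)]
    ring_nf
  have h2 : y ^ (d - 1) = y ^ (d - 1 / 2 - 1) * y ^ (1 / 2 : ℝ) := by
    rw [← Real.rpow_add hy]
    ring_nf
  have h3 : y ^ (1 / 2 : ℝ) ≠ 0 := by positivity
  have h4 : -(r - 0) ^ 2 / (2 * (2 * y)) = -(r ^ 2 / (4 * y)) := by
    field_simp
    ring
  rw [h1, h2, h4]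
  field_simp

/-- The Bessel integral appears from the Gaussian mixture through `y = |r| e^u / (2 λ)`. -/
lemma gaussianMixture_eq_lintegral_cosh {d lam r : ℝ} (hd : 0 < d) (hlam : 0 < lam) (hr : r ≠ 0) :
    gaussianMixture d lam r =
      ENNReal.ofReal ((2 * lam) ^ (1 / 2 - d) * (Real.Gamma d / Real.sqrt Real.pi) *
        |r| ^ (d - 1 / 2)) *
      ∫⁻ u in Set.Ioi (0 : ℝ), ENNReal.ofReal
        (Real.exp (-(lam * |r|) * Real.cosh u) * Real.cosh ((1 / 2 - d) * u)) := by
  have hG := Real.Gamma_pos_of_pos hd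
  have hr0 : 0 < |r| := abs_pos.2 hr
  set κ : ℝ := |r| / (2 * lam) with hκ
  have hκ0 : 0 < κ := by positivity
  have hκpow : κ ^ (d - 1 / 2) = |r| ^ (d - 1 / 2) * (2 * lam) ^ (1 / 2 - d) := by
    rw [hκ, Real.div_rpow hr0.le (by positivity), div_eq_mul_inv, ← Real.rpow_neg (by positivity)]
    ring_nf
  have hint : ∀ u : ℝ, ENNReal.ofReal (κ * Real.exp u) *
      (ENNReal.ofReal ((κ * Real.exp u) ^ (d - 1) * Real.exp (-(lam ^ 2 * (κ * Real.exp u)))) *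
        gaussianPDF 0 (2 * (κ * Real.exp u)).toNNReal r) =
      ENNReal.ofReal ((Real.sqrt (4 * Real.pi))⁻¹ * κ ^ (d - 1 / 2)) *
        ENNReal.ofReal (Real.exp ((d - 1 / 2) * u) *
          Real.exp (-(lam * |r|) * Real.cosh u)) := by
    intro u
    have hy : 0 < κ * Real.exp u := by positivity
    rw [gaussianMixture_integrand_eq d lam r hy, ← ENNReal.ofReal_mul hy.le,
      ← ENNReal.ofReal_mul (by positivity)]
    congr 1
    have e1 : (κ * Real.exp u) * (κ * Real.exp u) ^ (d - 1 / 2 - 1) =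
        κ ^ (d - 1 / 2) * Real.exp ((d - 1 / 2) * u) := by
      rw [Real.rpow_sub_one hy.ne', mul_div_cancel₀ _ hy.ne', Real.mul_rpow hκ0.le
        (Real.exp_pos _).le, ← Real.exp_mul, mul_comm u]
    have e2 : Real.exp (-(lam ^ 2 * (κ * Real.exp u))) *
        Real.exp (-(r ^ 2 / (4 * (κ * Real.exp u)))) =
        Real.exp (-(lam * |r|) * Real.cosh u) := by
      rw [← Real.exp_add, Real.cosh_eq, Real.exp_neg, hκ, ← sq_abs r]
      congr 1
      have := (Real.exp_pos u).ne'
      field_simp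
      ring
    calc _ = (Real.sqrt (4 * Real.pi))⁻¹ *
          ((κ * Real.exp u) * (κ * Real.exp u) ^ (d - 1 / 2 - 1)) *
          (Real.exp (-(lam ^ 2 * (κ * Real.exp u))) *
          Real.exp (-(r ^ 2 / (4 * (κ * Real.exp u))))) := by ring
      _ = _ := by
        rw [e1, e2]
        ring
  rw [gaussianMixture, setLIntegral_Ioi_eq_lintegral_mul_exp hκ0, lintegral_congr hint,
    lintegral_const_mul _ (by fun_prop), lintegral_exp_mul_even _ (by fun_prop)
    (fun _ => (Real.exp_pos _).le) (fun u => by rw [Real.cosh_neg]),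
    show (2 : ENNReal) = ENNReal.ofReal 2 by simp, ← mul_assoc, ← mul_assoc,
    ← ENNReal.ofReal_mul hG.le, ← ENNReal.ofReal_mul (by positivity)]
  congr 1
  · congr 1
    have h4 : Real.sqrt (4 * Real.pi) = 2 * Real.sqrt Real.pi := by
      rw [Real.sqrt_mul (by norm_num), show (4 : ℝ) = 2 ^ 2 by norm_num,
        Real.sqrt_sq (by norm_num)]
    have := Real.sqrt_pos.2 Real.pi_pos
    rw [h4, hκpow]
    field_simp
  · refine lintegral_congr fun u => ?_
    rw [← Real.cosh_neg ((1 / 2 - d) * u)]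
    ring_nf

lemma besselK_nonneg (ν x : ℝ) : 0 ≤ besselK ν x :=
  integral_nonneg fun _ => mul_nonneg (Real.exp_pos _).le (Real.cosh_pos _).le

lemma measurable_besselK (ν : ℝ) : Measurable (besselK ν) := by
  have h : Measurable fun p : ℝ × ℝ => Real.exp (-p.1 * Real.cosh p.2) * Real.cosh (ν * p.2) := by
    fun_prop
  exact (h.stronglyMeasurable.integral_prod_right' (ν := volume.restrict (Set.Ioi 0))).measurable

/-- The two-point function `K_{1/2-d}(λ |r|) |r|^{d - 1/2}`. -/
noncomputable def besselCov (d lam r : ℝ) : ℝ :=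
  besselK (1 / 2 - d) (lam * |r|) * |r| ^ (d - 1 / 2)

lemma besselCov_nonneg (d lam r : ℝ) : 0 ≤ besselCov d lam r :=
  mul_nonneg (besselK_nonneg _ _) (by positivity)

@[fun_prop]
lemma measurable_besselCov (d lam : ℝ) : Measurable (besselCov d lam) := by
  have := measurable_besselK (1 / 2 - d)
  unfold besselCov
  fun_prop

lemma temperedCov_ae_eq_besselCov {d lam : ℝ} (hd : 0 < d) (hlam : 0 < lam) :
    ∀ᵐ r, temperedCov d lam r = ENNReal.ofReal
      ((2 * lam) ^ (1 / 2 - d) * (Real.Gamma d / Real.sqrt Real.pi) * besselCov d lam r) := by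
  have hG := Real.Gamma_pos_of_pos hd
  obtain ⟨h1, h2⟩ := temperedCov_ae_eq_gaussianMixture hd hlam
  have h3 : ∀ᵐ r : ℝ, r ≠ 0 := by simp [ae_iff]
  filter_upwards [h1, ae_lt_top (measurable_temperedCov d lam) h2, h3] with r hr hfin hr0
  have hrpos : 0 < |r| := abs_pos.2 hr0
  rw [hr, gaussianMixture_eq_lintegral_cosh hd hlam hr0] at hfin
  have hpos : 0 < (2 * lam) ^ (1 / 2 - d) * (Real.Gamma d / Real.sqrt Real.pi) *
      |r| ^ (d - 1 / 2) := by
    have := Real.sqrt_pos.2 Real.pi_pos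
    positivity
  have hL := ENNReal.lt_top_of_mul_ne_top_right hfin.ne (by simpa using hpos)
  have hnn : ∀ u, 0 ≤ Real.exp (-(lam * |r|) * Real.cosh u) * Real.cosh ((1 / 2 - d) * u) :=
    fun _ => mul_nonneg (Real.exp_pos _).le (Real.cosh_pos _).le
  rw [hr, gaussianMixture_eq_lintegral_cosh hd hlam hr0, ← ofReal_integral_eq_lintegral_ofReal
    ⟨by fun_prop, by rwa [hasFiniteIntegral_iff_ofReal (Eventually.of_forall hnn)]⟩
    (Eventually.of_forall hnn), ← ENNReal.ofReal_mul hpos.le, besselCov, besselK]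
  congr 1
  ring

/-- The bound `e^{-z} ≤ z^{-α}` for `z = r² / (4 y)` controls the Gaussian mixture near `0`. -/
lemma gaussianMixture_le {d lam r α : ℝ} (hα0 : 0 ≤ α) (hα1 : α ≤ 1) (hr : r ≠ 0) :
    gaussianMixture d lam r ≤ ENNReal.ofReal (Real.Gamma d) *
      (ENNReal.ofReal ((r ^ 2 / 4) ^ (-α)) * gammaLIntegral (d - 1 / 2 + α) (lam ^ 2)) := by
  have hr0 : 0 < r ^ 2 := by positivity
  rw [gaussianMixture, gammaLIntegral]
  refine mul_le_mul_right ?_ _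
  rw [← lintegral_const_mul _ (by fun_prop)]
  refine setLIntegral_mono' measurableSet_Ioi fun y hy => ?_
  have hy0 : (0 : ℝ) < y := hy
  rw [gaussianMixture_integrand_eq d lam r hy0, ← ENNReal.ofReal_mul (by positivity)]
  refine ENNReal.ofReal_le_ofReal ?_
  have h1 : (Real.sqrt (4 * Real.pi))⁻¹ ≤ 1 := by
    refine inv_le_one_of_one_le₀ (Real.one_le_sqrt.2 ?_)
    linarith [Real.pi_gt_three]
  set z : ℝ := r ^ 2 / (4 * y) with hz
  have hz0 : 0 < z := by positivity
  have h2 : Real.exp (-z) ≤ z ^ (-α) := by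
    rw [Real.exp_neg, Real.rpow_neg hz0.le]
    refine inv_anti₀ (by positivity) ?_
    calc z ^ α ≤ (1 + z) ^ α := by gcongr; linarith
      _ ≤ (1 + z) ^ (1 : ℝ) := Real.rpow_le_rpow_of_exponent_le (by linarith) hα1
      _ ≤ Real.exp z := by rw [Real.rpow_one, add_comm]; exact Real.add_one_le_exp z
  have h3 : z ^ (-α) = (r ^ 2 / 4) ^ (-α) * y ^ α := by
    rw [hz, ← div_div, Real.div_rpow (by positivity) hy0.le, Real.rpow_neg hy0.le, div_inv_eq_mul]
  have h4 : y ^ (d - 1 / 2 + α - 1) = y ^ (d - 1 / 2 - 1) * y ^ α := by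
    rw [← Real.rpow_add hy0]
    ring_nf
  calc _ ≤ 1 * y ^ (d - 1 / 2 - 1) * Real.exp (-(lam ^ 2 * y)) * z ^ (-α) := by gcongr
    _ = _ := by rw [h3, h4]; ring

/-- Local square integrability of the covariance: this is where `d > 1/4` enters. -/
lemma setLIntegral_temperedCov_sq_ne_top {d lam : ℝ} (hd : 1 / 4 < d) (hlam : 0 < lam) (t : ℝ) :
    ∫⁻ r in Set.Ioc (-t) t, temperedCov d lam r ^ 2 ≠ ⊤ := by
  obtain ⟨α, hα0, hα1, hα2⟩ : ∃ α : ℝ, 0 ≤ α ∧ α < 1 / 4 ∧ 0 < d - 1 / 2 + α := by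
    refine ⟨max 0 ((1 / 4 + (1 / 2 - d)) / 2), le_max_left _ _, max_lt (by norm_num) ?_, ?_⟩
    · linarith
    · have := le_max_right 0 ((1 / 4 + (1 / 2 - d)) / 2)
      linarith
  obtain ⟨h1, -⟩ := temperedCov_ae_eq_gaussianMixture (lt_trans (by norm_num) hd) hlam
  have h3 : ∀ᵐ r : ℝ, r ≠ 0 := by simp [ae_iff]
  have hL := gammaLIntegral_of_pos hα2 (pow_pos hlam 2)
  set C : ENNReal := (ENNReal.ofReal (Real.Gamma d) *
    (ENNReal.ofReal ((1 / 4 : ℝ) ^ (-α)) * gammaLIntegral (d - 1 / 2 + α) (lam ^ 2))) ^ 2 with hC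
  have hCtop : C ≠ ⊤ := by
    rw [hC, hL]
    finiteness
  have hbd : ∀ᵐ r, temperedCov d lam r ^ 2 ≤ C * ENNReal.ofReal (|r| ^ (-4 * α)) := by
    filter_upwards [h1, h3] with r hr hr0
    have hrpos : 0 < |r| := abs_pos.2 hr0
    have e1 : (r ^ 2 / 4) ^ (-α) = (1 / 4 : ℝ) ^ (-α) * |r| ^ (-2 * α) := by
      rw [← sq_abs, div_eq_mul_one_div, Real.mul_rpow (by positivity) (by positivity),
        ← Real.rpow_natCast, ← Real.rpow_mul hrpos.le, mul_comm]
      push_cast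
      ring_nf
    have e2 : |r| ^ (-4 * α) = (|r| ^ (-2 * α)) ^ 2 := by
      rw [← Real.rpow_natCast, ← Real.rpow_mul hrpos.le]
      push_cast
      ring_nf
    rw [hr]
    refine (pow_le_pow_left' (gaussianMixture_le hα0 (by linarith) hr0) 2).trans_eq ?_
    rw [e1, e2, hC, ENNReal.ofReal_pow (by positivity), ENNReal.ofReal_mul (by positivity)]
    ring
  refine ((setLIntegral_mono_ae' measurableSet_Ioc (hbd.mono fun r h _ => h)).trans_lt ?_).ne
  rw [lintegral_const_mul _ (by fun_prop)]
  refine ENNReal.mul_lt_top hCtop.lt_top ?_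
  rcases lt_or_ge t 0 with ht | ht
  · rw [Set.Ioc_eq_empty (by linarith)]
    simp
  have hI : IntervalIntegrable (fun r : ℝ => |r| ^ (-4 * α)) volume 0 t := by
    refine (intervalIntegral.intervalIntegrable_rpow' (r := -4 * α) (by linarith)).congr
      fun r hr => ?_
    rw [Set.uIoc_of_le ht] at hr
    simp only [abs_of_pos hr.1]
  have hI' : IntervalIntegrable (fun r : ℝ => |r| ^ (-4 * α)) volume (-t) 0 := by
    simpa using ((IntervalIntegrable.iff_comp_neg).1 hI).symm
  have := ((intervalIntegrable_iff_integrableOn_Ioc_of_le (by linarith)).1 (hI'.trans hI)).2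
  rwa [hasFiniteIntegral_iff_ofReal (Eventually.of_forall fun _ => by positivity)] at this

/-! ### Cyclic integrals -/

section CyclicIntegral

variable {α : Type*} [MeasurableSpace α] {μ : Measure α} [SigmaFinite μ] {n : ℕ}

lemma lintegral_pi_succ {f : (Fin (n + 1) → α) → ENNReal} (hf : Measurable f) :
    ∫⁻ s, f s ∂(Measure.pi fun _ => μ) =
      ∫⁻ y, ∫⁻ s, f (Fin.cons y s) ∂(Measure.pi fun _ : Fin n => μ) ∂μ := by
  have h := (measurePreserving_piFinSuccAbove (fun _ : Fin (n + 1) => μ) 0).symm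
  rw [← h.lintegral_comp hf]
  refine (lintegral_prod (μ := μ) (ν := Measure.pi fun _ : Fin n => μ) _
    (hf.comp h.measurable).aemeasurable).trans ?_
  refine lintegral_congr fun y => lintegral_congr fun s => ?_
  simp [MeasurableEquiv.piFinSuccAbove, Fin.insertNthEquiv]

lemma lintegral_pi_prod {f : Fin n → α → ENNReal} (hf : ∀ j, Measurable (f j)) :
    ∫⁻ s, ∏ j, f j (s j) ∂(Measure.pi fun _ => μ) = ∏ j, ∫⁻ y, f j y ∂μ := by
  induction n with
  | zero => simp
  | succ n ih =>
    rw [lintegral_pi_succ (by fun_prop), Fin.prod_univ_succ, ← ih fun j => hf j.succ,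
      ← lintegral_mul_const _ (hf 0)]
    refine lintegral_congr fun y => ?_
    simp only [Fin.prod_univ_succ, Fin.cons_zero, Fin.cons_succ]
    exact lintegral_const_mul _ (by fun_prop)

/-- The `[0, ∞]`-valued composition powers of a kernel with respect to the measure `μ`:
`kernelPowE μ F n` is the composition of `n + 1` copies of `F`. -/
noncomputable def kernelPowE (μ : Measure α) (F : α × α → ENNReal) : ℕ → α × α → ENNReal
  | 0 => F
  | n + 1 => fun p => ∫⁻ y, F (p.1, y) * kernelPowE μ F n (y, p.2) ∂μ

lemma measurable_kernelPowE {F : α × α → ENNReal} (hF : Measurable F) (n : ℕ) :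
    Measurable (kernelPowE μ F n) := by
  induction n with
  | zero => exact hF
  | succ n ih =>
    have h : Measurable fun q : (α × α) × α => F (q.1.1, q.2) * kernelPowE μ F n (q.2, q.1.2) := by
      fun_prop
    exact h.lintegral_prod_right'

/-- A composition power is an integral over paths from `x` to `z`. -/
lemma kernelPowE_eq_lintegral_path {F : α × α → ENNReal} (hF : Measurable F) (n : ℕ) (x z : α) :
    kernelPowE μ F n (x, z) = ∫⁻ s : Fin n → α, ∏ j : Fin (n + 1),
      F ((Fin.cons x s : Fin (n + 1) → α) j, (Fin.snoc s z : Fin (n + 1) → α) j)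
        ∂(Measure.pi fun _ => μ) := by
  have hcons : ∀ (n : ℕ) (x : α), Measurable fun s : Fin n → α =>
      (Fin.cons x s : Fin (n + 1) → α) := by
    intro n x
    refine measurable_pi_iff.2 fun j => ?_
    refine Fin.cases ?_ (fun i => ?_) j
    · simp
    · simpa using measurable_pi_apply i
  have hsnoc : ∀ (n : ℕ) (z : α), Measurable fun s : Fin n → α =>
      (Fin.snoc s z : Fin (n + 1) → α) := by
    intro n x
    refine measurable_pi_iff.2 fun j => ?_
    refine Fin.lastCases ?_ (fun i => ?_) j
    · simp
    · simpa using measurable_pi_apply i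
  have hm : ∀ (n : ℕ) (x z : α), Measurable fun s : Fin n → α => ∏ j : Fin (n + 1),
      F ((Fin.cons x s : Fin (n + 1) → α) j, (Fin.snoc s z : Fin (n + 1) → α) j) := by
    intro n x z
    refine Finset.measurable_fun_prod _ fun j _ => hF.comp ?_
    exact ((measurable_pi_apply j).comp (hcons n x)).prodMk
      ((measurable_pi_apply j).comp (hsnoc n z))
  induction n generalizing x with
  | zero =>
    simp [kernelPowE, Fin.snoc]
  | succ n ih =>
    rw [lintegral_pi_succ (hm _ x z)]
    change ∫⁻ y, F (x, y) * kernelPowE μ F n (y, z) ∂μ = _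
    refine lintegral_congr fun y => ?_
    rw [ih y, ← lintegral_const_mul _ (hm n y z)]
    refine lintegral_congr fun s => ?_
    rw [Fin.prod_univ_succ (n := n + 1), ← Fin.cons_snoc_eq_snoc_cons]
    simp only [Fin.cons_zero, Fin.cons_succ]

/-- A cyclic integral is the trace of a composition power. -/
lemma lintegral_cyclic_eq {F : α × α → ENNReal} (hF : Measurable F) (n : ℕ) :
    ∫⁻ s : Fin (n + 2) → α, ∏ j, F (s j, s (finRotate (n + 2) j)) ∂(Measure.pi fun _ => μ) =
      ∫⁻ x, ∫⁻ y, F (x, y) * kernelPowE μ F n (y, x) ∂μ ∂μ := by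
  rw [lintegral_pi_succ (by fun_prop)]
  refine lintegral_congr fun x => ?_
  change _ = kernelPowE μ F (n + 1) (x, x)
  rw [kernelPowE_eq_lintegral_path hF]
  refine lintegral_congr fun s => Finset.prod_congr rfl fun j _ => ?_
  congr 2
  refine Fin.lastCases ?_ (fun i => ?_) j
  · rw [finRotate_last, Fin.snoc_last, Fin.cons_zero]
  · rw [Fin.snoc_castSucc, finRotate_apply, Fin.coeSucc_eq_succ, Fin.cons_succ]

end CyclicIntegral

/-- Composition powers may be computed with `[0, ∞]`-valued kernels. -/
lemma ofReal_kernelPow_ae_eq {F : ℝ × ℝ → ℝ} (hF : StronglyMeasurable F)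
    (hF2 : MemLp F 2 volume) (hF0 : ∀ p, 0 ≤ F p) {K : ℝ × ℝ → ENNReal}
    (hK : ∀ᵐ p, ENNReal.ofReal (F p) = K p) (n : ℕ) :
    (∀ p, 0 ≤ kernelPow F n p) ∧
      ∀ᵐ p, ENNReal.ofReal (kernelPow F n p) = kernelPowE volume K n p := by
  induction n with
  | zero => exact ⟨hF0, hK⟩
  | succ n ih =>
    obtain ⟨ih0, ih⟩ := ih
    have hnn : ∀ p : ℝ × ℝ, ∀ y, 0 ≤ F (p.1, y) * kernelPow F n (y, p.2) :=
      fun p y => mul_nonneg (hF0 _) (ih0 _)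
    refine ⟨fun p => integral_nonneg (hnn p), ?_⟩
    have h1 : ∀ᵐ p : ℝ × ℝ, ∀ᵐ y, ENNReal.ofReal (F (p.1, y)) = K (p.1, y) :=
      Measure.quasiMeasurePreserving_fst.ae (Measure.ae_ae_of_ae_prod hK)
    have h2 : ∀ᵐ p : ℝ × ℝ, ∀ᵐ y, ENNReal.ofReal (kernelPow F n (y, p.2)) =
        kernelPowE volume K n (y, p.2) := by
      have := Measure.measurePreserving_swap (μ := (volume : Measure ℝ))
        (ν := (volume : Measure ℝ)) |>.quasiMeasurePreserving.ae ih
      exact Measure.quasiMeasurePreserving_snd.ae (Measure.ae_ae_of_ae_prod this)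
    filter_upwards [ae_integrable_kernelComp hF (hF.kernelPow n) hF2 (MemLp.kernelPow hF hF2 n),
      h1, h2] with p hp hp1 hp2
    change ENNReal.ofReal (∫ y, F (p.1, y) * kernelPow F n (y, p.2)) = ∫⁻ y, _
    rw [ofReal_integral_eq_lintegral_ofReal hp (Eventually.of_forall (hnn p))]
    refine lintegral_congr_ae ?_
    filter_upwards [hp1, hp2] with y hy1 hy2
    rw [ENNReal.ofReal_mul (hF0 _), hy1, hy2]

/-- The trace of a power of a nonnegative kernel is a cyclic integral. -/
lemma ofReal_kernelTrace_kernelPow {F : ℝ × ℝ → ℝ} (hF : StronglyMeasurable F)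
    (hF2 : MemLp F 2 volume) (hF0 : ∀ p, 0 ≤ F p) {K : ℝ × ℝ → ENNReal} (hKm : Measurable K)
    (hK : ∀ᵐ p, ENNReal.ofReal (F p) = K p) (n : ℕ) :
    0 ≤ kernelTrace F (kernelPow F n) ∧ ENNReal.ofReal (kernelTrace F (kernelPow F n)) =
      ∫⁻ s : Fin (n + 2) → ℝ, ∏ j, K (s j, s (finRotate (n + 2) j)) := by
  obtain ⟨h0, hae⟩ := ofReal_kernelPow_ae_eq hF hF2 hF0 hK n
  have hnn : ∀ p : ℝ × ℝ, 0 ≤ F p * kernelPow F n p.swap := fun p => mul_nonneg (hF0 _) (h0 _)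
  refine ⟨integral_nonneg hnn, ?_⟩
  have hKn := measurable_kernelPowE (μ := (volume : Measure ℝ)) hKm n
  rw [kernelTrace, ofReal_integral_eq_lintegral_ofReal
    (integrable_mul_comp_swap (hF.kernelPow n) hF2 (MemLp.kernelPow hF hF2 n))
    (Eventually.of_forall hnn), volume_pi, lintegral_cyclic_eq hKm]
  have hsw := Measure.measurePreserving_swap (μ := (volume : Measure ℝ))
    (ν := (volume : Measure ℝ)) |>.quasiMeasurePreserving.ae hae
  calc _ = ∫⁻ p : ℝ × ℝ, K p * kernelPowE volume K n p.swap := by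
        refine lintegral_congr_ae ?_
        filter_upwards [hK, hsw] with p hp1 hp2
        rw [ENNReal.ofReal_mul (hF0 _), hp1, hp2]
    _ = _ := lintegral_prod _ (hKm.mul (hKn.comp measurable_swap)).aemeasurable

/-- `temperedKernel` with values in `[0, ∞]`. -/
noncomputable def temperedKernelE (d lam t : ℝ) (p : ℝ × ℝ) : ENNReal :=
  ∫⁻ s in Set.Icc 0 t, temperedPowerE d lam (s - p.1) * temperedPowerE d lam (s - p.2)

lemma measurable_temperedKernelE (d lam t : ℝ) : Measurable (temperedKernelE d lam t) := by
  have h : Measurable fun q : (ℝ × ℝ) × ℝ =>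
      temperedPowerE d lam (q.2 - q.1.1) * temperedPowerE d lam (q.2 - q.1.2) := by fun_prop
  exact h.lintegral_prod_right' (ν := volume.restrict (Set.Icc 0 t))

lemma temperedKernel_eq_toReal (d lam : ℝ) {t : ℝ} (ht : 0 ≤ t) (p : ℝ × ℝ) :
    temperedKernel d lam t p = (temperedKernelE d lam t p).toReal := by
  have := measurable_temperedPower d lam
  rw [temperedKernel, intervalIntegral.integral_of_le ht, integral_eq_lintegral_of_nonneg_ae
    (Eventually.of_forall fun s => mul_nonneg (temperedPower_nonneg _ _ _)
      (temperedPower_nonneg _ _ _)) (by fun_prop), temperedKernelE,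
    setLIntegral_congr Ioc_ae_eq_Icc]
  simp only [ENNReal.ofReal_mul (temperedPower_nonneg _ _ _), temperedPowerE]

lemma temperedCov_eq_lintegral_sub (d lam a b : ℝ) :
    ∫⁻ x, temperedPowerE d lam (a - x) * temperedPowerE d lam (b - x) =
      temperedCov d lam (b - a) := by
  rw [temperedCov, ← lintegral_sub_left_eq_self _ a]
  refine lintegral_congr fun x => ?_
  rw [sub_sub_cancel, show b - (a - x) = x + (b - a) by ring]

lemma temperedCov_neg (d lam r : ℝ) : temperedCov d lam (-r) = temperedCov d lam r := by
  have h1 := temperedCov_eq_lintegral_sub d lam r 0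
  have h2 := temperedCov_eq_lintegral_sub d lam 0 r
  rw [zero_sub] at h1
  rw [sub_zero] at h2
  rw [← h1, ← h2]
  simp only [mul_comm]

/-- Integrating out the noise variables of a cyclic product of tempered kernels leaves a cyclic
product of covariances. -/
lemma lintegral_cyclic_temperedKernelE (d lam t : ℝ) (m : ℕ) (σ : Equiv.Perm (Fin m)) :
    ∫⁻ x : Fin m → ℝ, ∏ j, temperedKernelE d lam t (x j, x (σ j)) =
      ∫⁻ s in Set.univ.pi fun _ : Fin m => Set.Icc 0 t, ∏ j, temperedCov d lam (s j - s (σ j)) := by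
  set μ : Measure ℝ := volume.restrict (Set.Icc 0 t)
  rw [volume_pi, Measure.restrict_pi_pi, ← volume_pi]
  calc _ = ∫⁻ x : Fin m → ℝ, ∫⁻ s : Fin m → ℝ, ∏ j, temperedPowerE d lam (s j - x j) *
        temperedPowerE d lam (s j - x (σ j)) ∂(Measure.pi fun _ : Fin m => μ) := by
        refine lintegral_congr fun x => ?_
        exact (lintegral_pi_prod (f := fun j s => temperedPowerE d lam (s - x j) *
          temperedPowerE d lam (s - x (σ j))) (by fun_prop)).symm
    _ = ∫⁻ s : Fin m → ℝ, (∫⁻ x : Fin m → ℝ, ∏ j, temperedPowerE d lam (s j - x j) *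
        temperedPowerE d lam (s j - x (σ j))) ∂(Measure.pi fun _ : Fin m => μ) := by
        refine lintegral_lintegral_swap (Measurable.aemeasurable ?_)
        fun_prop
    _ = _ := by
        refine lintegral_congr fun s => ?_
        -- relabel by `σ` so that the factors containing `x j` come together
        have hre : ∀ x : Fin m → ℝ, ∏ j, temperedPowerE d lam (s j - x j) *
            temperedPowerE d lam (s j - x (σ j)) =
            ∏ j, temperedPowerE d lam (s (σ j) - x (σ j)) *
              temperedPowerE d lam (s j - x (σ j)) := by
          intro x
          rw [Finset.prod_mul_distrib, Finset.prod_mul_distrib]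
          congr 1
          exact (Equiv.prod_comp σ fun j => temperedPowerE d lam (s j - x j)).symm
        have hre' : ∀ x : Fin m → ℝ, ∏ j, temperedPowerE d lam (s j - x j) *
            temperedPowerE d lam (s j - x (σ j)) = ∏ j, temperedPowerE d lam (s j - x j) *
              temperedPowerE d lam (s (σ.symm j) - x j) := by
          intro x
          rw [hre, ← Equiv.prod_comp σ fun j => temperedPowerE d lam (s j - x j) *
              temperedPowerE d lam (s (σ.symm j) - x j)]
          simp only [Equiv.symm_apply_apply]
        simp only [hre', volume_pi]
        rw [lintegral_pi_prod (f := fun j x => temperedPowerE d lam (s j - x) *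
          temperedPowerE d lam (s (σ.symm j) - x)) (by fun_prop),
          ← Equiv.prod_comp σ]
        simp only [Equiv.symm_apply_apply, temperedCov_eq_lintegral_sub]

lemma temperedKernelE_swap (d lam t : ℝ) (p : ℝ × ℝ) :
    temperedKernelE d lam t p.swap = temperedKernelE d lam t p := by
  simp only [temperedKernelE, Prod.fst_swap, Prod.snd_swap, mul_comm]

/-- The cyclic formula for two variables bounds the `L²` norm of the kernel by the local `L²` norm
of the covariance. -/
lemma lintegral_temperedKernelE_sq_ne_top {d lam : ℝ} (hd : 1 / 4 < d) (hlam : 0 < lam) (t : ℝ) :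
    ∫⁻ p, temperedKernelE d lam t p ^ 2 ≠ ⊤ := by
  have hm := measurable_temperedKernelE d lam t
  have hc := measurable_temperedCov d lam
  have h1 : ∫⁻ p, temperedKernelE d lam t p ^ 2 = ∫⁻ s in Set.univ.pi fun _ : Fin 2 => Set.Icc 0 t,
      ∏ j, temperedCov d lam (s j - s (finRotate 2 j)) := by
    rw [← lintegral_cyclic_temperedKernelE, volume_pi, lintegral_cyclic_eq hm 0]
    refine (lintegral_prod _ (hm.pow_const 2).aemeasurable).trans ?_
    refine lintegral_congr fun x => lintegral_congr fun y => ?_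
    change _ = _ * temperedKernelE d lam t (x, y).swap
    rw [temperedKernelE_swap, sq]
  have h2 : Measurable fun p : ℝ × ℝ => temperedCov d lam (p.1 - p.2) := by fun_prop
  rw [h1, volume_pi, Measure.restrict_pi_pi, lintegral_cyclic_eq h2 0]
  have h3 : ∀ x ∈ Set.Icc 0 t, ∫⁻ y in Set.Icc 0 t,
      temperedCov d lam (x - y) * kernelPowE (volume.restrict (Set.Icc 0 t))
        (fun p : ℝ × ℝ => temperedCov d lam (p.1 - p.2)) 0 (y, x) ≤
      ∫⁻ r in Set.Ioc (-t) t, temperedCov d lam r ^ 2 := by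
    intro x hx
    rw [setLIntegral_congr Ioc_ae_eq_Icc, ← lintegral_indicator measurableSet_Icc,
      ← lintegral_indicator measurableSet_Icc, ← lintegral_sub_left_eq_self _ x]
    refine lintegral_mono fun y => ?_
    by_cases hy : x - y ∈ Set.Icc 0 t
    · have hxy : y ∈ Set.Icc (-t) t := ⟨by linarith [hx.1, hy.2], by linarith [hx.2, hy.1]⟩
      rw [Set.indicator_of_mem hy, Set.indicator_of_mem hxy, sq, sub_sub_cancel]
      change _ * temperedCov d lam (x - y - x) ≤ _
      rw [show x - y - x = -y by ring, temperedCov_neg]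
    · rw [Set.indicator_of_notMem hy]
      exact zero_le
  refine ((setLIntegral_mono' measurableSet_Icc h3).trans_lt ?_).ne
  rw [setLIntegral_const]
  exact ENNReal.mul_lt_top (setLIntegral_temperedCov_sq_ne_top hd hlam t).lt_top (by simp)

lemma stronglyMeasurable_temperedKernel (d lam : ℝ) {t : ℝ} (ht : 0 ≤ t) :
    StronglyMeasurable (temperedKernel d lam t) := by
  rw [funext (temperedKernel_eq_toReal d lam ht)]
  exact (measurable_temperedKernelE d lam t).ennreal_toReal.stronglyMeasurable

lemma ofReal_temperedKernel_ae_eq {d lam t : ℝ} (hd : 1 / 4 < d) (hlam : 0 < lam) (ht : 0 ≤ t) :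
    ∀ᵐ p, ENNReal.ofReal (temperedKernel d lam t p) = temperedKernelE d lam t p := by
  have hm := measurable_temperedKernelE d lam t
  filter_upwards [ae_lt_top (hm.pow_const 2) (lintegral_temperedKernelE_sq_ne_top hd hlam t)]
    with p hp
  rw [temperedKernel_eq_toReal d lam ht, ENNReal.ofReal_toReal]
  rintro h
  simp [h] at hp

lemma temperedKernel_nonneg (d lam : ℝ) {t : ℝ} (ht : 0 ≤ t) (p : ℝ × ℝ) :
    0 ≤ temperedKernel d lam t p := by
  rw [temperedKernel_eq_toReal d lam ht]
  exact ENNReal.toReal_nonneg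

lemma memLp_temperedKernel {d lam t : ℝ} (hd : 1 / 4 < d) (hlam : 0 < lam) (ht : 0 ≤ t) :
    MemLp (temperedKernel d lam t) 2 (volume : Measure (ℝ × ℝ)) := by
  refine ⟨(stronglyMeasurable_temperedKernel d lam ht).aestronglyMeasurable, ?_⟩
  have h : eLpNorm (temperedKernel d lam t) 2 volume ^ 2 ≠ ⊤ := by
    rw [eLpNorm_two_sq]
    refine ne_top_of_le_ne_top (lintegral_temperedKernelE_sq_ne_top hd hlam t)
      (lintegral_mono_ae ?_)
    filter_upwards [ofReal_temperedKernel_ae_eq hd hlam ht] with p hp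
    rw [Real.enorm_of_nonneg (temperedKernel_nonneg d lam ht p), hp]
  exact lt_top_iff_ne_top.2 fun h' => h (by simp [h'])

/-! ### The cumulants of the tempered Rosenblatt process -/

lemma cyclicBesselProduct_eq (d lam : ℝ) (m : ℕ) (s : Fin m → ℝ) :
    cyclicBesselProduct d lam m s = ∏ j, besselCov d lam (s j - s (finRotate m j)) := rfl

lemma finRotate_ne_self {n : ℕ} (j : Fin (n + 2)) : finRotate (n + 2) j ≠ j := by
  rw [finRotate_apply]
  simp

/-- Almost every point of `ℝ^m` has all its cyclic differences in a given conull set. -/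
lemma ae_cyclic_sub {A : Set ℝ} (hA : MeasurableSet A) (h : ∀ᵐ r, r ∈ A) (n : ℕ) :
    ∀ᵐ s : Fin (n + 2) → ℝ, ∀ j, s j - s (finRotate (n + 2) j) ∈ A := by
  refine ae_all_iff.2 fun j => ?_
  let L : (Fin (n + 2) → ℝ) →ₗ[ℝ] ℝ :=
    LinearMap.proj (R := ℝ) (φ := fun _ => ℝ) j -
      LinearMap.proj (R := ℝ) (φ := fun _ => ℝ) (finRotate (n + 2) j)
  have hL : Function.Surjective L := by
    intro r
    refine ⟨Pi.single j r, ?_⟩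
    simp only [L, LinearMap.sub_apply, LinearMap.proj_apply, Pi.single_eq_same,
      Pi.single_eq_of_ne (finRotate_ne_self j), sub_zero]
  exact (ae_comp_linearMap_mem_iff L volume volume hL hA).2 h

/-- The traces of the composition powers of the tempered kernel are Bessel integrals. -/
lemma kernelTrace_temperedKernel {d lam t : ℝ} (hd : 1 / 4 < d) (hlam : 0 < lam) (ht : 0 ≤ t)
    (n : ℕ) :
    IntegrableOn (cyclicBesselProduct d lam (n + 2))
      (Set.univ.pi fun _ : Fin (n + 2) => Set.Icc (0 : ℝ) t) ∧
    kernelTrace (temperedKernel d lam t) (kernelPow (temperedKernel d lam t) n) =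
      ((2 * lam) ^ (1 / 2 - d) * (Real.Gamma d / Real.sqrt Real.pi)) ^ (n + 2) *
        ∫ s in Set.univ.pi fun _ : Fin (n + 2) => Set.Icc (0 : ℝ) t,
          cyclicBesselProduct d lam (n + 2) s := by
  have hd0 : 0 < d := lt_trans (by norm_num) hd
  have hG := Real.Gamma_pos_of_pos hd0
  have hpi := Real.sqrt_pos.2 Real.pi_pos
  set C : ℝ := (2 * lam) ^ (1 / 2 - d) * (Real.Gamma d / Real.sqrt Real.pi) with hC
  have hC0 : 0 < C := by positivity
  obtain ⟨h0, htr⟩ := ofReal_kernelTrace_kernelPow (stronglyMeasurable_temperedKernel d lam ht)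
    (memLp_temperedKernel hd hlam ht) (temperedKernel_nonneg d lam ht)
    (measurable_temperedKernelE d lam t) (ofReal_temperedKernel_ae_eq hd hlam ht) n
  have hnn : ∀ s, 0 ≤ cyclicBesselProduct d lam (n + 2) s := fun s =>
    Finset.prod_nonneg fun _ _ => besselCov_nonneg _ _ _
  have hmeas : Measurable (cyclicBesselProduct d lam (n + 2)) := by
    rw [funext (cyclicBesselProduct_eq d lam (n + 2))]
    fun_prop
  have hbes : ∀ᵐ s : Fin (n + 2) → ℝ,
      ∏ j, temperedCov d lam (s j - s (finRotate (n + 2) j)) =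
        ENNReal.ofReal (C ^ (n + 2)) * ENNReal.ofReal (cyclicBesselProduct d lam (n + 2) s) := by
    have hc := measurable_temperedCov d lam
    have hA : MeasurableSet {r | temperedCov d lam r = ENNReal.ofReal (C * besselCov d lam r)} :=
      measurableSet_eq_fun hc (by fun_prop)
    filter_upwards [ae_cyclic_sub hA (temperedCov_ae_eq_besselCov hd0 hlam) n] with s hs
    rw [Finset.prod_congr rfl fun j _ => hs j, ← ENNReal.ofReal_mul (by positivity),
      ← ENNReal.ofReal_prod_of_nonneg fun j _ => mul_nonneg hC0.le (besselCov_nonneg _ _ _),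
      Finset.prod_mul_distrib, cyclicBesselProduct_eq]
    simp
  rw [lintegral_cyclic_temperedKernelE, lintegral_congr_ae (ae_restrict_of_ae hbes),
    lintegral_const_mul _ hmeas.ennreal_ofReal] at htr
  have hCpos : 0 < C ^ (n + 2) := by positivity
  have hfin := ENNReal.lt_top_of_mul_ne_top_right (htr ▸ ENNReal.ofReal_ne_top)
    (by simpa using hCpos)
  have hint : IntegrableOn (cyclicBesselProduct d lam (n + 2))
      (Set.univ.pi fun _ : Fin (n + 2) => Set.Icc (0 : ℝ) t) :=
    ⟨hmeas.aestronglyMeasurable, by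
      rwa [hasFiniteIntegral_iff_ofReal (Eventually.of_forall hnn)]⟩
  refine ⟨hint, ?_⟩
  rw [← ofReal_integral_eq_lintegral_ofReal hint (Eventually.of_forall hnn),
    ← ENNReal.ofReal_mul hCpos.le] at htr
  exact (ENNReal.ofReal_eq_ofReal_iff h0
    (mul_nonneg hCpos.le (integral_nonneg hnn))).1 htr

theorem lemma5p4 {Ω : Type*} [MeasurableSpace Ω] (P : Measure Ω) [IsProbabilityMeasure P]
    (W : Lp ℝ 2 (volume : Measure ℝ) → Ω → ℝ) (hW : IsIsonormal W P)
    (H d lam : ℝ) (hH : 1 / 2 < H) (hd : d = 1 / 2 - (1 - H) / 2) (hlam : 0 < lam) :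
    (∃ Z : ℝ → Ω → ℝ, IsTemperedRosenblatt W P d lam Z) ∧
    ∀ Z : ℝ → Ω → ℝ, IsTemperedRosenblatt W P d lam Z →
      ∀ t : ℝ, 0 ≤ t →
        0 ∈ interior (integrableExpSet (Z t) P) ∧
        ∀ m : ℕ, 2 ≤ m →
          IntegrableOn (cyclicBesselProduct d lam m)
            (Set.univ.pi fun _ : Fin m => Set.Icc (0 : ℝ) t) ∧
          cumulant m (Z t) P =
            (2 : ℝ) ^ ((m : ℝ) - 1 + (1 / 2 - d) * m) * (Nat.factorial (m - 1) : ℝ) *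
              lam ^ ((1 / 2 - d) * m) * (Real.Gamma d / Real.sqrt Real.pi) ^ m *
              ∫ s in Set.univ.pi fun _ : Fin m => Set.Icc (0 : ℝ) t,
                cyclicBesselProduct d lam m s := by
  have hd4 : 1 / 4 < d := by linarith
  constructor
  · choose X hX using fun t : {t : ℝ // 0 ≤ t} =>
      exists_isDoubleWienerIntegral hW (memLp_temperedKernel hd4 hlam t.2)
    exact ⟨fun t => if ht : 0 ≤ t then X ⟨t, ht⟩ else 0, fun t ht => by
      simpa only [dif_pos ht] using hX ⟨t, ht⟩⟩
  · intro Z hZ t ht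
    have hsymm : ∀ x, temperedKernel d lam t x.swap = temperedKernel d lam t x := fun x => by
      rw [temperedKernel_eq_toReal d lam ht, temperedKernel_eq_toReal d lam ht,
        temperedKernelE_swap]
    obtain ⟨hexp, hcum⟩ := cumulant_doubleWienerIntegral hW
      (stronglyMeasurable_temperedKernel d lam ht) hsymm (hZ t ht)
    refine ⟨hexp, fun m hm => ?_⟩
    obtain ⟨n, rfl⟩ := Nat.exists_eq_add_of_le' hm
    obtain ⟨hint, htr⟩ := kernelTrace_temperedKernel hd4 hlam ht n
    refine ⟨hint, ?_⟩
    have e1 : ((2 * lam) ^ (1 / 2 - d)) ^ (n + 2) =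
        (2 : ℝ) ^ ((1 / 2 - d) * ((n + 2 : ℕ) : ℝ)) * lam ^ ((1 / 2 - d) * ((n + 2 : ℕ) : ℝ)) := by
      rw [← Real.rpow_natCast, ← Real.rpow_mul (by positivity),
        Real.mul_rpow (by norm_num) hlam.le]
    have e2 : (2 : ℝ) ^ (((n + 2 : ℕ) : ℝ) - 1) = 2 ^ (n + 1) := by
      rw [← Real.rpow_natCast]
      push_cast
      ring_nf
    rw [hcum, htr, mul_pow, e1, Real.rpow_add two_pos, e2, show n + 2 - 1 = n + 1 by omega]
    ring
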